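/- Let $n \ge 2$. Let $M$ be an $n$-dimensional (geometric) simplicial complex in $\mathbb{R}^n$, and let $u$ be an interior vertex of $M$, i.e. a vertex such that the underlying space of its link is homeomorphic to the sphere $S^{n-1}$. Let $L = \mathrm{Lk}\,u$ be the link of $u$, regarded as the complex of those faces of simplices of $M$ incident to $u$ that do not have $u$ as a vertex. Suppose there exists an abstract finite $n$-dimensional simplicial complex $K$ such that (i) $K$ is an $n$-manifold complex (with boundary), i.e. its underlying space $|K|$ is a topological $n$-manifold with (possibly empty) boundary; (ii) the boundary complex $\partial K$, which consists of the $(n-1)$-simplices of $K$ that lie in exactly one $n$-simplex of $K$ and of all faces of these, is isomorphic to $L$ as a simplicial complex; and (iii) every $n$-simplex $\sigma$ of $K$ has at least two facets ($(n-1)$-dimensional faces) that belong to $\partial K$ (identified with $L$ by (ii)). Then $\mathrm{cone}(u, L) = \{\mathrm{cone}(u,\tau) : \tau \in L\}$ is not $n$-well-centered: it is not the case that every $n$-simplex in $\mathrm{cone}(u, L)$ contains its circumcenter in its interior. Here $\mathrm{cone}(u,\tau)$ is the simplex spanned by $u$ and the vertices of $\tau$. -/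

import Mathlib

namespace OneRing

section Abstract

variable {V W : Type*}

/-- The vertices of an abstract simplicial complex, whose simplices are nonempty finite sets
of vertices. -/
def vertices (K : PreAbstractSimplicialComplex V) : Set V :=
  {v | {v} ∈ K.faces}

/-- The complex `K` has dimension `n`: every simplex has at most `n + 1` vertices, and
some simplex has exactly `n + 1` vertices. -/
def HasDimension (n : ℕ) (K : PreAbstractSimplicialComplex V) : Prop :=
  (∀ s ∈ K.faces, s.card ≤ n + 1) ∧ ∃ s ∈ K.faces, s.card = n + 1

/-- The underlying space of an abstract simplicial complex `K` in barycentric coordinates: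
points are the families of nonnegative weights of total mass one that are supported on a
simplex of `K`.  It carries the topology of a subspace of `V → ℝ`, which is the usual
topology when `K` is finite (the only case in which it is used). -/
def realization (K : PreAbstractSimplicialComplex V) : Set (V → ℝ) :=
  {x | (∀ v, 0 ≤ x v) ∧ ∃ s ∈ K.faces, (∀ v, v ∉ s → x v = 0) ∧ ∑ v ∈ s, x v = 1}

/-- Topological `n`-manifolds with (possibly empty) boundary: Hausdorff, second countable, and
every point has an open neighbourhood homeomorphic to an open subset of the closed
half-space of dimension `n`. -/
def IsTopologicalManifoldWithBoundary (n : ℕ) [NeZero n] (X : Type*) [TopologicalSpace X] :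
    Prop :=
  T2Space X ∧ SecondCountableTopology X ∧
    ∀ x : X, ∃ e : OpenPartialHomeomorph X (EuclideanHalfSpace n), x ∈ e.source

/-- An `n`-manifold complex (with boundary): a simplicial complex whose underlying space is a
topological `n`-manifold with (possibly empty) boundary. -/
def IsManifoldComplex (n : ℕ) [NeZero n] (K : PreAbstractSimplicialComplex V) : Prop :=
  IsTopologicalManifoldWithBoundary n (realization K)

/-- The boundary complex `∂K` of an `n`-manifold complex `K`: it consists of the
`(n - 1)`-simplices of `K` (those with `n` vertices) that are incident to exactly one
`n`-simplex of `K`, together with all their faces. -/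
def boundary (n : ℕ) (K : PreAbstractSimplicialComplex V) : PreAbstractSimplicialComplex V where
  faces := {t | t.Nonempty ∧ ∃ τ ∈ K.faces, τ.card = n ∧
    (∃! σ : Finset V, σ ∈ K.faces ∧ σ.card = n + 1 ∧ τ ⊆ σ) ∧ t ⊆ τ}
  isRelLowerSet_faces := by
    rintro t ⟨ht, τ, hτ, hcard, huniq, hsub⟩
    exact ⟨ht, fun s hst hs => ⟨hs, τ, hτ, hcard, huniq, hst.trans hsub⟩⟩

/-- Two abstract simplicial complexes are isomorphic if there is a bijection between their vertices
under which simplices correspond to simplices in both directions. -/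
def IsIsomorphic (K : PreAbstractSimplicialComplex V) (L : PreAbstractSimplicialComplex W) :
    Prop :=
  ∃ e : vertices K ≃ vertices L, ∀ s : Finset (vertices K),
    s.map (Function.Embedding.subtype _) ∈ K.faces ↔
      (s.map e.toEmbedding).map (Function.Embedding.subtype _) ∈ L.faces

end Abstract

section Geometric

/-- The link of `u` in a geometric simplicial complex `M`: the complex of those faces of
simplices incident to `u` that do not have `u` as a vertex.  Its underlying space is the
closed star of `u` minus the star of `u`. -/
def link {E : Type*} [AddCommGroup E] [Module ℝ E] (M : Geometry.SimplicialComplex ℝ E) (u : E) :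
    Geometry.SimplicialComplex ℝ E where
  faces := {t | t ∈ M.faces ∧ u ∉ t ∧ ∃ s ∈ M.faces, u ∈ s ∧ t ⊆ s}
  isRelLowerSet_faces := by
    rintro t ⟨ht, hut, s, hs, hus, hts⟩
    exact ⟨M.nonempty_of_mem_faces ht, fun r hrt hr =>
      ⟨M.down_closed ht hrt hr, fun h => hut (hrt h), s, hs, hus, hrt.trans hts⟩⟩
  indep := fun hs => M.indep hs.1
  inter_subset_convexHull := fun hs ht => M.inter_subset_convexHull hs.1 ht.1

/-- `u` is an interior vertex of the complex `M` in `ℝⁿ`: it is a vertex of `M`, and the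
underlying space of its link is homeomorphic to the sphere of dimension `n - 1`. -/
def IsInteriorVertex {n : ℕ} (M : Geometry.SimplicialComplex ℝ (EuclideanSpace ℝ (Fin n)))
    (u : EuclideanSpace ℝ (Fin n)) : Prop :=
  u ∈ M.vertices ∧
    Nonempty ((link M u).space ≃ₜ Metric.sphere (0 : EuclideanSpace ℝ (Fin n)) 1)

/-- `cone u S` is the set of the simplices spanned by `u` and a simplex in `S`; a simplex
is given by its set of vertices. -/
def cone {E : Type*} (u : E) (S : Set (Finset E)) : Set (Finset E) :=
  {s | ∃ t ∈ S, (s : Set E) = insert u (t : Set E)}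

/-- A set `S` of simplices (given by their vertex sets) is `k`-well-centered, where `1 ≤ k`, if every
`k`-simplex in `S` contains its circumcenter in its (relative) interior. -/
def IsWellCentered {E : Type*} [NormedAddCommGroup E] [InnerProductSpace ℝ E] (k : ℕ)
    (S : Set (Finset E)) : Prop :=
  ∀ p : Affine.Simplex ℝ E k, (∃ s ∈ S, Set.range p.points = (s : Set E)) →
    p.circumcenter ∈ p.interior

end Geometric

end OneRing

/-!
Suppose `cone u L`, with `L` the link of `u`, were well-centered.  The isomorphism of `∂K` with `L`
gives a map `f` from the vertices of `K` to `ℝⁿ`: every vertex of an `n`-simplex `σ` of `K` lies in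
`∂K`, because two different facets of `σ` do.  Put `p v = f v - u`.

*Geometry.*  Let two facets of `σ` belong to `∂K`.  Their joins with `u` are well-centered simplices
with a common facet containing `u`.  The circumcenters of both simplices project to the
circumcenter `u + m` of that common facet.  Since the barycentric coordinates of an interior
circumcenter are less than `1 / 2`, one gets `⟪m, p v⟫ > 0` for all vertices `v` of `σ`
(`exists_inner_pos_of_hasInteriorCircumcenter`).  Hence `u` is not in the convex hull of `f '' σ`,
and a generic ray from `u` meets an even number of the images of the facets of `σ`
(`even_card_filter_inCone_erase`).

*Topology.*  As `|K|` is a manifold, every `(n - 1)`-simplex of `K` lies in at most two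
`n`-simplices (`card_cofaces_le_two`).  Otherwise three half-balls glued along a common
`(n - 1)`-ball would embed in `ℝⁿ`, against invariance of domain (`image_closedBall_mem_nhds_of_injOn`).  That theorem is
deduced from Brouwer's fixed point theorem, which in turn rests on a volume computation
(`no_contDiff_retraction`).

*Counting.*  Summing over the `n`-simplices of `K` and working modulo `2`, only the facets in `∂K`
survive, so that a generic ray from `u` meets an even number of the `(n - 1)`-simplices of `L`
(`even_card_boundary_filter`).  But the cones from `u` over the simplices of `L` belong to the
geometric complex `M`, hence do not overlap (`mem_span_inter_of_inCone`), and a generic ray inside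
one of them meets exactly one `(n - 1)`-simplex of `L`.
-/

namespace OneRing

/-! ### Brouwer's fixed point theorem -/

section InvarianceOfDomain

open Set Metric MeasureTheory Topology

open scoped NNReal ContDiff

variable {E : Type*} [NormedAddCommGroup E] [InnerProductSpace ℝ E]

/-- Since `t ↦ det (1 + t • A)` is a polynomial of degree at most `dim E`, its value at `1` is a
combination of its values at `dim E + 1` nodes, with coefficients that do not depend on `A`. -/
theorem det_one_add_eq_sum_lagrange [FiniteDimensional ℝ E] (A : E →L[ℝ] E) {v : ℕ → ℝ}
    (hv : Function.Injective v) :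
    (1 + A).det = ∑ j ∈ Finset.range (Module.finrank ℝ E + 1),
      (Lagrange.basis (Finset.range (Module.finrank ℝ E + 1)) v j).eval 1 *
        (1 + v j • A).det := by
  classical
  let b := Module.finBasis ℝ E
  let M := LinearMap.toMatrix b b (A : E →ₗ[ℝ] E)
  -- the polynomial `t ↦ det (1 + t • A)`
  let P : Polynomial ℝ := ((Polynomial.X : Polynomial ℝ) • M.map Polynomial.C +
    (1 : Matrix _ _ ℝ).map Polynomial.C).det
  have hP : ∀ t : ℝ, P.eval t = (1 + t • A).det := by
    intro t
    have h1 : P.eval t = (t • M + 1).det := by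
      simp only [P]
      rw [← Polynomial.coe_evalRingHom, RingHom.map_det]
      congr 1
      ext i j
      by_cases hij : i = j
      · subst hij; simp; ring
      · simp [Matrix.one_apply_ne hij]; ring
    have h2 : t • M + 1 = LinearMap.toMatrix b b ((1 + t • A : E →L[ℝ] E) : E →ₗ[ℝ] E) := by
      have : ((1 + t • A : E →L[ℝ] E) : E →ₗ[ℝ] E) = t • (A : E →ₗ[ℝ] E) + 1 := by
        ext x; simp [add_comm]
      rw [this, map_add, map_smul, LinearMap.toMatrix_one]
    rw [h1, h2, LinearMap.det_toMatrix]
  have hdeg : P.degree < (Finset.range (Module.finrank ℝ E + 1)).card := by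
    have h := Polynomial.natDegree_det_X_add_C_le M 1
    rw [Finset.card_range]
    refine lt_of_le_of_lt Polynomial.degree_le_natDegree ?_
    rw [Fintype.card_fin] at h
    exact_mod_cast Nat.lt_succ_of_le h
  have h := congrArg (Polynomial.eval 1) (Lagrange.eq_interpolate (v := v) hv.injOn hdeg)
  rw [hP, one_smul, Lagrange.interpolate_apply, Polynomial.eval_finsetSum] at h
  rw [h]
  refine Finset.sum_congr rfl fun j _ => ?_
  rw [Polynomial.eval_mul, Polynomial.eval_C, hP, mul_comm]

/-- A map that is Lipschitz on a closed ball and vanishes on the bounding sphere stays Lipschitz,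
with the same constant, when extended by zero. -/
theorem lipschitzWith_indicator_closedBall {g : E → E} {R : ℝ} {C : ℝ≥0}
    (hg : LipschitzOnWith C g (closedBall 0 R)) (h0 : ∀ x, ‖x‖ = R → g x = 0) :
    LipschitzWith C ((closedBall (0 : E) R).indicator g) := by
  have key : ∀ x y : E, ‖x‖ ≤ R → R < ‖y‖ → ‖g x‖ ≤ C * ‖x - y‖ := by
    intro x y hx hy
    have hc : ContinuousOn (fun t : ℝ => ‖x + t • (y - x)‖) (Icc 0 1) := by fun_prop
    have hmem : R ∈ Icc (‖x + (0 : ℝ) • (y - x)‖) (‖x + (1 : ℝ) • (y - x)‖) := by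
      simp only [zero_smul, add_zero, one_smul, add_sub_cancel]
      exact ⟨hx, hy.le⟩
    obtain ⟨t, ht, hzt⟩ := intermediate_value_Icc zero_le_one hc hmem
    have hd := hg.dist_le_mul x (by simpa using hx) (x + t • (y - x))
      (by simpa using le_of_eq hzt)
    rw [h0 _ hzt, dist_zero_right, dist_eq_norm] at hd
    refine hd.trans (mul_le_mul_of_nonneg_left ?_ C.2)
    rw [show x - (x + t • (y - x)) = t • (x - y) by module, norm_smul, Real.norm_eq_abs,
      abs_of_nonneg ht.1]
    exact mul_le_of_le_one_left (norm_nonneg _) ht.2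
  refine LipschitzWith.of_dist_le_mul fun x y => ?_
  by_cases hx : x ∈ closedBall (0 : E) R <;> by_cases hy : y ∈ closedBall (0 : E) R
  · rw [indicator_of_mem hx, indicator_of_mem hy]
    exact hg.dist_le_mul x hx y hy
  · rw [indicator_of_mem hx, indicator_of_notMem hy, dist_zero_right, dist_eq_norm]
    exact key x y (by simpa using hx) (by simpa using hy)
  · rw [indicator_of_notMem hx, indicator_of_mem hy, dist_zero_left, dist_comm, dist_eq_norm]
    exact key y x (by simpa using hy) (by simpa using hx)
  · rw [indicator_of_notMem hx, indicator_of_notMem hy, dist_self]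
    positivity

/-- There is no `C¹` retraction of a closed ball onto its boundary sphere.  If `r` were one, put
`f t x = x + t • (r x - x)`.  For small `t > 0` this is a bijection of the ball onto itself with
positive Jacobian, so that `∫ det (D (f t))` over the ball is the volume of the ball.  Being
polynomial in `t`, the integral has that value at `t = 1` as well, where however the integrand
vanishes because `r` takes its values in a sphere. -/
theorem no_contDiff_retraction [FiniteDimensional ℝ E] {R : ℝ} (hR : 0 < R) {r : E → E}
    (hr : ContDiff ℝ 1 r) (hnorm : ∀ x, ‖r x‖ = R) (hid : ∀ x, ‖x‖ = R → r x = x) : False := by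
  borelize E
  have hnt : Nontrivial E := ⟨r 0, 0, fun h => by
    have := hnorm 0; rw [h, norm_zero] at this; exact hR.ne this⟩
  let μ : Measure E := Measure.addHaar
  let g : E → E := fun x => r x - x
  have hg : ContDiff ℝ 1 g := hr.sub contDiff_id
  have hgd : Continuous (fderiv ℝ g) := hg.continuous_fderiv one_ne_zero
  have hcpt : IsCompact (closedBall (0 : E) R) := isCompact_closedBall 0 R
  obtain ⟨C, hC⟩ : ∃ C : ℝ≥0, ∀ x ∈ closedBall (0 : E) R, ‖fderiv ℝ g x‖₊ ≤ C := by
    obtain ⟨C, hC⟩ := hcpt.exists_bound_of_continuousOn hgd.continuousOn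
    refine ⟨C.toNNReal, fun x hx => ?_⟩
    rw [← NNReal.coe_le_coe, coe_nnnorm]
    exact (hC x hx).trans (Real.le_coe_toNNReal C)
  have hlip : LipschitzOnWith C g (closedBall 0 R) :=
    Convex.lipschitzOnWith_of_nnnorm_fderiv_le
      (fun x _ => (hg.differentiable one_ne_zero) x) hC (convex_closedBall 0 R)
  let G : E → E := (closedBall (0 : E) R).indicator g
  have hG : LipschitzWith C G :=
    lipschitzWith_indicator_closedBall hlip fun x hx => by simp [g, hid x hx]
  -- The Jacobian of `f t` is positive for small `t`.
  obtain ⟨η, hη, hdet⟩ : ∃ η > 0, ∀ B : E →L[ℝ] E, ‖B‖ < η → 0 < (1 + B).det := by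
    have h1 : (0 : ℝ) < (1 : E →L[ℝ] E).det := by
      simp [ContinuousLinearMap.det]
    have h2 := (ContinuousLinearMap.continuous_det (𝕜 := ℝ) (E := E)).tendsto 1
    obtain ⟨η, hη, h3⟩ := Metric.eventually_nhds_iff.1 (h2.eventually (lt_mem_nhds h1))
    exact ⟨η, hη, fun B hB => h3 (by simpa [dist_eq_norm] using hB)⟩
  -- For `0 < t ≤ δ`: `t < 1`, so `f t` preserves the ball; `t * C < 1`, so `f t` is bijective; and
  -- `t * C < η`, so the Jacobian is positive.
  let δ : ℝ := min (1 / 2) (min (1 / (2 * (C + 1))) (η / (2 * (C + 1))))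
  have hC1 : (0 : ℝ) < 2 * (C + 1) := by positivity
  have hδ : 0 < δ := lt_min (by norm_num) (lt_min (by positivity) (by positivity))
  have hvol : ∀ t : ℝ, 0 < t → t ≤ δ →
      ∫ x in ball (0 : E) R, (1 + t • fderiv ℝ g x).det ∂μ = μ.real (ball (0 : E) R) := by
    intro t ht htδ
    have ht1 : t < 1 := by
      have : δ ≤ 1 / 2 := min_le_left _ _
      linarith
    have htC : t * C < 1 := by
      have h : δ ≤ 1 / (2 * (C + 1)) := (min_le_right _ _).trans (min_le_left _ _)
      have : t * (2 * (C + 1)) ≤ 1 := (le_div_iff₀ hC1).1 (htδ.trans h)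
      nlinarith [C.2]
    have htη : t * C < η := by
      have h : δ ≤ η / (2 * (C + 1)) := (min_le_right _ _).trans (min_le_right _ _)
      have : t * (2 * (C + 1)) ≤ η := (le_div_iff₀ hC1).1 (htδ.trans h)
      nlinarith [C.2, mul_nonneg ht.le C.2]
    let F : E → E := fun x => x + t • G x
    have happ : ApproximatesLinearOn F ((ContinuousLinearEquiv.refl ℝ E : E ≃L[ℝ] E) : E →L[ℝ] E)
        univ (t.toNNReal * C) := by
      rw [ApproximatesLinearOn.approximatesLinearOn_iff_lipschitzOnWith, lipschitzOnWith_univ]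
      refine LipschitzWith.of_dist_le_mul fun x y => ?_
      have := hG.dist_le_mul x y
      simp only [F, Pi.sub_apply, ContinuousLinearEquiv.coe_coe, ContinuousLinearEquiv.refl_apply,
        add_sub_cancel_left, dist_smul₀, Real.norm_eq_abs, abs_of_pos ht]
      rw [NNReal.coe_mul, Real.coe_toNNReal _ ht.le, mul_assoc]
      exact mul_le_mul_of_nonneg_left this ht.le
    have hc : Subsingleton E ∨ t.toNNReal * C < ‖(((ContinuousLinearEquiv.refl ℝ E).symm :
        E ≃L[ℝ] E) : E →L[ℝ] E)‖₊⁻¹ := by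
      right
      rw [ContinuousLinearEquiv.refl_symm, ContinuousLinearEquiv.coe_refl]
      rw [ContinuousLinearMap.nnnorm_id, inv_one, ← NNReal.coe_lt_coe, NNReal.coe_mul,
        Real.coe_toNNReal _ ht.le]
      exact htC
    have hinj := injOn_univ.1 (happ.injOn hc)
    have hsurj := happ.surjective hc
    have hF_in : ∀ x ∈ ball (0 : E) R, F x = x + t • g x := fun x hx => by
      simp only [F, G, indicator_of_mem (ball_subset_closedBall hx)]
    have himage : (fun x => x + t • g x) '' ball (0 : E) R = ball 0 R := by
      apply Subset.antisymm
      · rintro _ ⟨x, hx, rfl⟩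
        rw [mem_ball_zero_iff] at hx ⊢
        calc ‖x + t • g x‖ = ‖(1 - t) • x + t • r x‖ := by congr 1; simp only [g]; module
          _ ≤ (1 - t) * ‖x‖ + t * R := by
            refine (norm_add_le _ _).trans ?_
            rw [norm_smul, norm_smul, hnorm, Real.norm_eq_abs, Real.norm_eq_abs,
              abs_of_pos ht, abs_of_pos (by linarith)]
          _ < R := by nlinarith
      · intro y hy
        obtain ⟨x, rfl⟩ := hsurj y
        have hx : x ∈ ball (0 : E) R := by
          by_contra hx
          have hGx : G x = 0 := by
            by_cases hxR : ‖x‖ = R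
            · have : x ∈ closedBall (0 : E) R := by simp [hxR]
              simp only [G, indicator_of_mem this, g, hid x hxR, sub_self]
            · refine indicator_of_notMem (fun h => hx ?_) _
              rw [mem_closedBall_zero_iff] at h
              rw [mem_ball_zero_iff]
              exact lt_of_le_of_ne h hxR
          simp only [F, hGx, smul_zero, add_zero] at hy
          exact hx hy
        exact ⟨x, hx, (hF_in x hx).symm⟩
    have hinj' : InjOn (fun x => x + t • g x) (ball (0 : E) R) := fun x hx y hy h =>
      hinj (by rw [hF_in x hx, hF_in y hy]; exact h)
    have hder : ∀ x ∈ ball (0 : E) R, HasFDerivWithinAt (fun x => x + t • g x)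
        (1 + t • fderiv ℝ g x) (ball 0 R) x := fun x _ =>
      ((hasFDerivAt_id x).add
        (((hg.differentiable one_ne_zero x).hasFDerivAt).const_smul t)).hasFDerivWithinAt
    have h := integral_image_eq_integral_abs_det_fderiv_smul μ measurableSet_ball hder hinj'
      (fun _ => (1 : ℝ))
    rw [himage, setIntegral_const, smul_eq_mul, mul_one] at h
    rw [h]
    refine setIntegral_congr_fun measurableSet_ball fun x hx => ?_
    have hpos : 0 < (1 + t • fderiv ℝ g x).det := by
      apply hdet
      rw [norm_smul, Real.norm_eq_abs, abs_of_pos ht]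
      have : ‖fderiv ℝ g x‖ ≤ C := hC x (ball_subset_closedBall hx)
      nlinarith
    simp only [smul_eq_mul, mul_one, abs_of_pos hpos]
  -- At `t = 1` the differential is that of `r`, which is not surjective.
  have hdet0 : ∀ x, (1 + fderiv ℝ g x).det = 0 := by
    intro x
    have hrd := (hr.differentiable one_ne_zero) x
    have h1 : 1 + fderiv ℝ g x = fderiv ℝ r x := by
      have : fderiv ℝ g x = fderiv ℝ r x - ContinuousLinearMap.id ℝ E :=
        (hrd.hasFDerivAt.sub (hasFDerivAt_id x)).fderiv
      rw [this]; ext v; simp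
    rw [h1]
    by_contra hne
    have hort : ∀ v, inner ℝ (r x) (fderiv ℝ r x v) = 0 := by
      intro v
      have h2 := (hrd.hasFDerivAt.norm_sq)
      have h3 : (fun y => ‖r y‖ ^ 2) = fun _ => R ^ 2 := by funext y; rw [hnorm]
      rw [h3] at h2
      have h4 := congrArg (fun L => L v) (h2.unique (hasFDerivAt_const (R ^ 2) x))
      simpa using h4
    have hsur : Function.Surjective (fderiv ℝ r x) := by
      have hu : IsUnit (LinearMap.det (fderiv ℝ r x : E →ₗ[ℝ] E)) := isUnit_iff_ne_zero.2 hne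
      intro y
      obtain ⟨v, hv⟩ := (LinearMap.equivOfIsUnitDet hu).surjective y
      exact ⟨v, by simpa using hv⟩
    obtain ⟨v, hv⟩ := hsur (r x)
    have := hort v
    rw [hv, inner_self_eq_zero] at this
    have h5 := hnorm x
    rw [this, norm_zero] at h5
    exact hR.ne h5
  let v : ℕ → ℝ := fun j => δ / (j + 1)
  have hv : Function.Injective v := by
    intro i j hij
    have hi : ((i : ℝ) + 1) ≠ 0 := by positivity
    have hj : ((j : ℝ) + 1) ≠ 0 := by positivity
    simp only [v] at hij
    rw [div_eq_div_iff hi hj] at hij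
    have := mul_left_cancel₀ hδ.ne' hij
    exact_mod_cast (add_right_cancel this).symm
  have hv0 : ∀ j, 0 < v j := fun j => by positivity
  have hvδ : ∀ j, v j ≤ δ := fun j =>
    div_le_self hδ.le (by have : (0 : ℝ) ≤ j := j.cast_nonneg
                          linarith)
  set s := Finset.range (Module.finrank ℝ E + 1) with hs
  have hint : ∀ j ∈ s, Integrable (fun x => (Lagrange.basis s v j).eval 1 *
      (1 + v j • fderiv ℝ g x).det) (μ.restrict (ball 0 R)) := by
    intro j _
    apply IntegrableOn.mono_set _ ball_subset_closedBall
    apply ContinuousOn.integrableOn_compact hcpt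
    apply Continuous.continuousOn
    have hA : Continuous fun x => 1 + v j • fderiv ℝ g x := by fun_prop
    exact continuous_const.mul (ContinuousLinearMap.continuous_det.comp hA)
  have htotal : ∫ x in ball (0 : E) R, (1 + fderiv ℝ g x).det ∂μ = μ.real (ball (0 : E) R) := by
    simp_rw [fun x => det_one_add_eq_sum_lagrange (fderiv ℝ g x) hv]
    rw [integral_finsetSum _ hint]
    simp_rw [integral_const_mul]
    rw [Finset.sum_congr rfl fun j _ => by rw [hvol (v j) (hv0 j) (hvδ j)]]
    rw [← Finset.sum_mul, ← Polynomial.eval_finsetSum,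
      Lagrange.sum_basis hv.injOn ⟨0, by simp [hs]⟩, Polynomial.eval_one, one_mul]
  simp_rw [hdet0, integral_zero] at htotal
  exact (ENNReal.toReal_pos (measure_ball_pos μ 0 hR).ne' measure_ball_lt_top.ne).ne htotal

variable [FiniteDimensional ℝ E]

/-- If `e` had no fixed point, `H x = x - χ x • e x`, with `χ` a bump function, would vanish nowhere
and agree with the identity far out, and a multiple of `H / ‖H‖` would retract a ball onto its
sphere. -/
theorem exists_fixedPoint_of_contDiff_of_norm_le {e : E → E} {C : ℝ} (he : ContDiff ℝ 1 e)
    (hC : 0 < C) (hbd : ∀ x, ‖e x‖ ≤ C) : ∃ x, e x = x := by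
  by_contra! hne
  let χ : ContDiffBump (0 : E) := ⟨C, C + 1, hC, by linarith⟩
  let H : E → E := fun x => x - χ x • e x
  have hH : ContDiff ℝ 1 H := contDiff_id.sub (χ.contDiff.smul he)
  have hH0 : ∀ x, H x ≠ 0 := by
    intro x hx
    have hx' : x = χ x • e x := sub_eq_zero.1 hx
    have hxC : ‖x‖ ≤ C := by
      rw [hx', norm_smul, Real.norm_eq_abs, abs_of_nonneg χ.nonneg]
      exact (mul_le_of_le_one_left (norm_nonneg _) χ.le_one).trans (hbd x)
    rw [χ.one_of_mem_closedBall (by simpa using hxC), one_smul] at hx'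
    exact hne x hx'.symm
  have hout : ∀ x, ‖x‖ = C + 1 → H x = x := by
    intro x hx
    have : χ x = 0 := χ.zero_of_le_dist (by simp [χ, hx])
    simp [H, this]
  refine no_contDiff_retraction (R := C + 1) (r := fun x => ((C + 1) / ‖H x‖) • H x) (by linarith)
    ?_ ?_ ?_
  · refine ContDiff.smul (contDiff_const.div (hH.norm ℝ hH0) fun x => ?_) hH
    exact norm_ne_zero_iff.2 (hH0 x)
  · intro x
    rw [norm_smul, Real.norm_eq_abs, abs_of_nonneg (by positivity),
      div_mul_cancel₀ _ (norm_ne_zero_iff.2 (hH0 x))]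
  · intro x hx
    simp only [hout x hx, hx]
    rw [div_self (by linarith), one_smul]

/-- **Brouwer's fixed point theorem** for a continuous map of the whole space with bounded
range. -/
theorem exists_fixedPoint_of_norm_le_one {e : E → E} (he : Continuous e)
    (hbd : ∀ x, ‖e x‖ ≤ 1) : ∃ x, e x = x := by
  let χ : ContDiffBump (0 : E) := ⟨1, 2, one_pos, one_lt_two⟩
  let h : E → E := fun x => χ x • e x
  have hh : Continuous h := χ.continuous.smul he
  have hhb : ∀ x, ‖h x‖ ≤ 1 := by
    intro x
    simp only [h]
    rw [norm_smul, Real.norm_eq_abs, abs_of_nonneg χ.nonneg]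
    exact (mul_le_of_le_one_left (norm_nonneg _) χ.le_one).trans (hbd x)
  have huc : UniformContinuous h :=
    HasCompactSupport.uniformContinuous_of_continuous χ.hasCompactSupport.smul_right hh
  obtain ⟨x₀, hx₀, hmin⟩ := (isCompact_closedBall (0 : E) 2).exists_isMinOn
    ⟨0, by simp⟩ (f := fun x => ‖h x - x‖) (hh.sub continuous_id).norm.continuousOn
  have hfix : h x₀ = x₀ := by
    by_contra hne
    have hpos : 0 < ‖h x₀ - x₀‖ := norm_pos_iff.2 (sub_ne_zero.2 hne)
    obtain ⟨g, hg, hgd⟩ := huc.exists_contDiff_dist_le (lt_min hpos one_pos)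
    obtain ⟨x, hx⟩ := exists_fixedPoint_of_contDiff_of_norm_le (C := 2)
      (hg.of_le (by simp)) two_pos fun x => by
        have h1 : ‖g x - h x‖ < 1 := by
          rw [← dist_eq_norm]; exact (hgd x).trans_le (min_le_right _ _)
        calc ‖g x‖ = ‖h x + (g x - h x)‖ := by congr 1; abel
          _ ≤ ‖h x‖ + ‖g x - h x‖ := norm_add_le _ _
          _ ≤ 2 := by linarith [hhb x]
    have h1 : ‖g x - h x‖ < ‖h x₀ - x₀‖ := by
      rw [← dist_eq_norm]; exact (hgd x).trans_le (min_le_left _ _)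
    have h1' : ‖g x - h x‖ < 1 := by
      rw [← dist_eq_norm]; exact (hgd x).trans_le (min_le_right _ _)
    have hx2 : x ∈ closedBall (0 : E) 2 := by
      rw [mem_closedBall_zero_iff]
      calc ‖x‖ = ‖h x + (g x - h x)‖ := by rw [hx]; congr 1; abel
        _ ≤ ‖h x‖ + ‖g x - h x‖ := norm_add_le _ _
        _ ≤ 2 := by linarith [hhb x]
    have h2 : ‖h x₀ - x₀‖ ≤ ‖h x - x‖ := hmin hx2
    rw [hx, norm_sub_rev] at h1
    linarith
  refine ⟨x₀, ?_⟩
  have hx1 : ‖x₀‖ ≤ 1 := by rw [← hfix]; exact hhb x₀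
  have : χ x₀ = 1 := χ.one_of_mem_closedBall (by simpa using hx1)
  simpa [h, this] using hfix

/-- **Brouwer's fixed point theorem** for the closed unit ball. -/
theorem exists_fixedPoint_of_continuousOn_closedBall {e : E → E}
    (he : ContinuousOn e (closedBall 0 1)) (hbd : ∀ x ∈ closedBall (0 : E) 1, ‖e x‖ ≤ 1) :
    ∃ x ∈ closedBall (0 : E) 1, e x = x := by
  obtain ⟨g, hg, hge⟩ := ContinuousMap.exists_forall_mem_restrict_eq
    (isClosed_closedBall (x := (0 : E)) (ε := 1))
    ⟨fun x : closedBall (0 : E) 1 => e x, he.domRestrict⟩ (t := closedBall (0 : E) 1)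
    (fun x => mem_closedBall_zero_iff.2 (hbd x x.2))
  obtain ⟨x, hx⟩ := exists_fixedPoint_of_norm_le_one g.continuous fun x => by simpa using hg x
  have hx1 : x ∈ closedBall (0 : E) 1 := hx ▸ hg x
  have hgx : g x = e x := DFunLike.congr_fun hge ⟨x, hx1⟩
  exact ⟨x, hx1, hgx.symm.trans hx⟩

/-! ### Invariance of domain -/

/-- A continuous map that is nonzero on a compact set `S` can be approximated on `S` and on a sphere
by a continuous map which vanishes nowhere on their union: approximate by a smooth map, and subtract
a small vector outside the image of the sphere, which has measure zero. -/
theorem exists_continuous_approx_ne_zero {G : E → E} (hG : Continuous G) {S : Set E}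
    (hS : IsCompact S) (hGS : ∀ y ∈ S, G y ≠ 0) (c : E) {ε : ℝ} (hε : 0 < ε) {δ : ℝ}
    (hδ : 0 < δ) :
    ∃ P : E → E, Continuous P ∧ (∀ y ∈ S ∪ sphere c ε, P y ≠ 0) ∧
      ∀ y ∈ S ∪ sphere c ε, ‖G y - P y‖ ≤ δ := by
  borelize E
  let μ : Measure E := Measure.addHaar
  obtain ⟨d, hd, hdS⟩ : ∃ d > 0, ∀ y ∈ S, d ≤ ‖G y‖ := by
    rcases S.eq_empty_or_nonempty with rfl | hne
    · exact ⟨1, one_pos, by simp⟩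
    · obtain ⟨y, hy, hmin⟩ := hS.exists_isMinOn hne hG.norm.continuousOn
      exact ⟨‖G y‖, norm_pos_iff.2 (hGS y hy), fun z hz => hmin hz⟩
  set δ' := min δ d with hδ'
  have hδ'pos : 0 < δ' := lt_min hδ hd
  have hK : IsCompact (S ∪ sphere c ε) := hS.union (isCompact_sphere c ε)
  obtain ⟨Q, hQ, hQG⟩ : ∃ Q : E → E, ContDiff ℝ ∞ Q ∧
      ∀ y ∈ S ∪ sphere c ε, ‖G y - Q y‖ < δ' / 2 := by
    have h := ContinuousMap.dense_setOfPred_contDiff (E := E) (F := E) ⟨G, hG⟩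
    rw [mem_closure_iff_nhds_basis (nhds_basis_uniformity
      uniformity_basis_dist.compactConvergenceUniformity)] at h
    obtain ⟨Q, hQ, hQG⟩ := h (S ∪ sphere c ε, δ' / 2) ⟨hK, by positivity⟩
    refine ⟨Q, hQ, fun y hy => ?_⟩
    have := hQG y hy
    rw [norm_sub_rev, ← dist_eq_norm]
    exact this
  have hnull : μ (Q '' sphere c ε) = 0 :=
    addHaar_image_eq_zero_of_differentiableOn_of_addHaar_eq_zero μ
      (hQ.differentiable (by simp)).differentiableOn (Measure.addHaar_sphere_of_ne_zero μ c hε.ne')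
  -- the sphere has measure zero, and so has its image under the smooth map `Q`
  obtain ⟨v, hv, hvQ⟩ : ∃ v ∈ ball (0 : E) (δ' / 2), v ∉ Q '' sphere c ε := by
    by_contra! hsub
    have h1 : 0 < μ (ball (0 : E) (δ' / 2)) := measure_ball_pos μ 0 (by positivity)
    exact h1.ne' (measure_mono_null hsub hnull)
  rw [mem_ball_zero_iff] at hv
  have happ : ∀ y ∈ S ∪ sphere c ε, ‖G y - (Q y - v)‖ < δ' := by
    intro y hy
    calc ‖G y - (Q y - v)‖ = ‖(G y - Q y) + v‖ := by congr 1; abel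
      _ ≤ ‖G y - Q y‖ + ‖v‖ := norm_add_le _ _
      _ < δ' := by linarith [hQG y hy]
  refine ⟨fun y => Q y - v, hQ.continuous.sub continuous_const, fun y hy h0 => ?_, fun y hy =>
    (happ y hy).le.trans (min_le_left _ _)⟩
  have h0' : Q y - v = 0 := h0
  rcases hy with hy | hy
  · have h1 := happ y (Or.inl hy)
    rw [h0', sub_zero] at h1
    exact absurd (hdS y hy) (not_le.2 (h1.trans_le (min_le_right _ _)))
  · exact hvQ ⟨y, hy, sub_eq_zero.1 h0'⟩

/-- **Invariance of domain**.  The inverse of `f` extends to a continuous map `G`.  If `f 0` were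
not interior to the image, one could push the image off a ball around a nearby omitted point `c` and
compose with an approximation of `G` to get a map `x ↦ P (Φ (f x))` that vanishes nowhere on the
ball yet is at distance at most `1` from the identity, against Brouwer's theorem. -/
theorem image_closedBall_mem_nhds_of_injOn {f : E → E} (hf : ContinuousOn f (closedBall 0 1))
    (hinj : InjOn f (closedBall 0 1)) : f '' closedBall 0 1 ∈ 𝓝 (f 0) := by
  by_contra hnot
  have h01 : (0 : E) ∈ closedBall (0 : E) 1 := by simp
  have hemb : IsClosedEmbedding ((closedBall (0 : E) 1).domRestrict f) :=
    Continuous.isClosedEmbedding hf.domRestrict hinj.injective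
  obtain ⟨G, hG⟩ := ContinuousMap.exists_extension hemb
    ⟨((↑) : closedBall (0 : E) 1 → E), continuous_subtype_val⟩
  have hGf : ∀ x ∈ closedBall (0 : E) 1, G (f x) = x := fun x hx =>
    DFunLike.congr_fun hG ⟨x, hx⟩
  have hG0 : G (f 0) = 0 := hGf 0 h01
  obtain ⟨ε', hε', hGε⟩ : ∃ ε' > 0, ∀ y, dist y (f 0) < ε' → ‖G y‖ < 1 / 4 := by
    have h1 := (G.continuous.norm.tendsto (f 0)).eventually
      (gt_mem_nhds (show ‖G (f 0)‖ < 1 / 4 by rw [hG0, norm_zero]; norm_num))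
    obtain ⟨ε', hε', h2⟩ := Metric.eventually_nhds_iff.1 h1
    exact ⟨ε', hε', fun y hy => h2 hy⟩
  set ε := ε' / 2 with hεdef
  have hε : 0 < ε := by positivity
  obtain ⟨c, hc, hcK⟩ : ∃ c, dist c (f 0) < ε ∧ c ∉ f '' closedBall 0 1 := by
    by_contra! h
    exact hnot (Metric.mem_nhds_iff.2 ⟨ε, hε, fun y hy => h y hy⟩)
  have hKc : IsCompact (f '' closedBall (0 : E) 1) :=
    (isCompact_closedBall 0 1).image_of_continuousOn hf
  let S : Set E := f '' closedBall 0 1 ∩ {y | ε ≤ ‖y - c‖}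
  have hS : IsCompact S := hKc.inter_right
    (isClosed_le continuous_const (continuous_id.sub continuous_const).norm)
  have hGS : ∀ y ∈ S, G y ≠ 0 := by
    rintro _ ⟨⟨x, hx, rfl⟩, hy⟩ h0
    rw [hGf x hx] at h0
    rw [h0, mem_ofPred_eq, ← dist_eq_norm, dist_comm] at hy
    exact absurd hc (not_lt.2 hy)
  obtain ⟨P, hP, hP0, hPG⟩ := exists_continuous_approx_ne_zero G.continuous hS hGS c hε
    (show (0 : ℝ) < 1 / 4 by norm_num)
  have hne : ∀ x ∈ closedBall (0 : E) 1, ‖f x - c‖ ≠ 0 := fun x hx h => by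
    rw [norm_eq_zero, sub_eq_zero] at h
    exact hcK ⟨x, hx, h⟩
  -- `Φ` pushes the punctured open ball of radius `ε` around `c` onto its boundary sphere.
  let Φ : E → E := fun y => c + max (ε / ‖y - c‖) 1 • (y - c)
  have hΦc : ContinuousOn (fun x => Φ (f x)) (closedBall 0 1) := by
    have h1 : ContinuousOn (fun x => f x - c) (closedBall 0 1) := hf.sub continuousOn_const
    have h2 : ContinuousOn (fun x => ε / ‖f x - c‖) (closedBall 0 1) :=
      continuousOn_const.div h1.norm hne
    exact continuousOn_const.add ((h2.sup continuousOn_const).smul h1)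
  have hΦ_far : ∀ y, ε ≤ ‖y - c‖ → Φ y = y := by
    intro y hy
    have : max (ε / ‖y - c‖) 1 = 1 := max_eq_right ((div_le_one (hε.trans_le hy)).2 hy)
    simp [Φ, this]
  have hΦ_near : ∀ x ∈ closedBall (0 : E) 1, ‖f x - c‖ < ε → ‖Φ (f x) - c‖ = ε := by
    intro x hx hy
    have hpos : 0 < ‖f x - c‖ := lt_of_le_of_ne (norm_nonneg _) (hne x hx).symm
    have : max (ε / ‖f x - c‖) 1 = ε / ‖f x - c‖ := max_eq_left ((one_le_div hpos).2 hy.le)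
    simp only [Φ, this, add_sub_cancel_left]
    rw [norm_smul, Real.norm_eq_abs, abs_of_pos (by positivity), div_mul_cancel₀ _ hpos.ne']
  have hΦS : ∀ x ∈ closedBall (0 : E) 1, Φ (f x) ∈ S ∪ sphere c ε := by
    intro x hx
    rcases le_or_gt ε ‖f x - c‖ with hy | hy
    · left
      rw [hΦ_far _ hy]
      exact ⟨⟨x, hx, rfl⟩, hy⟩
    · right
      rw [mem_sphere_iff_norm]
      exact hΦ_near x hx hy
  have hclose : ∀ x ∈ closedBall (0 : E) 1, ‖x - P (Φ (f x))‖ ≤ 1 := by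
    intro x hx
    have hPΦ := hPG _ (hΦS x hx)
    rcases le_or_gt ε ‖f x - c‖ with hy | hy
    · rw [hΦ_far _ hy, hGf x hx] at hPΦ
      rw [hΦ_far _ hy]
      linarith
    · have hn := hΦ_near x hx hy
      have h1 : ‖G (f x)‖ < 1 / 4 := hGε _ (by
        have := dist_triangle (f x) c (f 0)
        rw [dist_eq_norm (f x) c] at this
        linarith)
      have h2 : ‖G (Φ (f x))‖ < 1 / 4 := hGε _ (by
        have := dist_triangle (Φ (f x)) c (f 0)
        rw [dist_eq_norm (Φ (f x)) c] at this
        linarith)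
      rw [hGf x hx] at h1
      calc ‖x - P (Φ (f x))‖
          = ‖x + -G (Φ (f x)) + (G (Φ (f x)) - P (Φ (f x)))‖ := by congr 1; abel
        _ ≤ ‖x‖ + ‖-G (Φ (f x))‖ + ‖G (Φ (f x)) - P (Φ (f x))‖ := norm_add₃_le
        _ ≤ 1 := by rw [norm_neg]; linarith
  obtain ⟨x, hx, hfix⟩ := exists_fixedPoint_of_continuousOn_closedBall
    (e := fun x => x - P (Φ (f x))) (continuousOn_id.sub (hP.comp_continuousOn hΦc)) hclose
  exact hP0 _ (hΦS x hx) (by simpa using hfix)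

end InvarianceOfDomain

/-! ### Facets of a manifold complex -/

section Facets

open Set Metric Topology Filter

variable {V : Type*}

/-- Barycentric coordinates for two simplices `insert a τ` and `insert b τ` of dimension `n` glued
along the common facet `τ`, whose `n` vertices are numbered by `idx`.  A point `y` of `ℝⁿ`, with
coordinate sum `s`, is sent to the first simplex if `s ≤ 0` and to the second one if `0 ≤ s`; the
weight of the vertex off `τ` is `|s|`, and the origin goes to the barycenter of `τ`. -/
noncomputable def twoPage [DecidableEq V] {n : ℕ} {τ : Finset V} (idx : τ ≃ Fin n) (a b : V)
    (y : EuclideanSpace ℝ (Fin n)) : V → ℝ := fun v =>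
  if h : v ∈ τ then 1 / n + y (idx ⟨v, h⟩) - (|∑ i, y i| + ∑ i, y i) / n
  else if v = a then (|∑ i, y i| - ∑ i, y i) / 2
  else if v = b then (|∑ i, y i| + ∑ i, y i) / 2
  else 0

theorem continuous_twoPage [DecidableEq V] {n : ℕ} {τ : Finset V} (idx : τ ≃ Fin n) (a b : V) :
    Continuous (twoPage idx a b) := by
  refine continuous_pi fun v => ?_
  unfold twoPage
  by_cases h : v ∈ τ
  · simp only [h, dite_true]; fun_prop
  · simp only [h, dite_false]
    split_ifs <;> fun_prop

theorem twoPage_injective [DecidableEq V] {n : ℕ} {τ : Finset V} (idx : τ ≃ Fin n) {a b : V}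
    (ha : a ∉ τ) (hb : b ∉ τ) (hab : a ≠ b) : Function.Injective (twoPage idx a b) := by
  intro y z hyz
  have h1 := congrFun hyz a
  have h2 := congrFun hyz b
  simp only [twoPage, ha, hb, dite_false, if_true, hab.symm, if_false] at h1 h2
  have hs : ∑ i, y i = ∑ i, z i := by linarith
  ext i
  have h3 := congrFun hyz (idx.symm i)
  simp only [twoPage, (idx.symm i).2, dite_true, Subtype.coe_eta, Equiv.apply_symm_apply, hs] at h3
  linarith

theorem twoPage_mem_realization [DecidableEq V] {n : ℕ} (hn : 0 < n)
    {K : PreAbstractSimplicialComplex V} {τ : Finset V} (idx : τ ≃ Fin n) {a b : V} (ha : a ∉ τ)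
    (hb : b ∉ τ) (hab : a ≠ b) (haK : insert a τ ∈ K.faces) (hbK : insert b τ ∈ K.faces)
    {y : EuclideanSpace ℝ (Fin n)} (hy : ‖y‖ ≤ 1 / (3 * n)) :
    twoPage idx a b y ∈ realization K := by
  have hn' : (0 : ℝ) < n := by exact_mod_cast hn
  -- The weights on `τ` equal `1 / n` at the barycenter and differ from it by at most `3 * ‖y‖`.
  set s := ∑ i, y i with hs
  have hyi : ∀ i, |y i| ≤ 1 / (3 * n) := fun i => by
    have := PiLp.norm_apply_le y i
    rw [Real.norm_eq_abs] at this
    exact this.trans hy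
  have hsb : |s| ≤ 1 / 3 := by
    calc |s| ≤ ∑ i, |y i| := Finset.abs_sum_le_sum_abs _ _
      _ ≤ ∑ _i : Fin n, 1 / (3 * (n : ℝ)) := Finset.sum_le_sum fun i _ => hyi i
      _ = 1 / 3 := by
        rw [Finset.sum_const, Finset.card_univ, Fintype.card_fin, nsmul_eq_mul]
        field_simp
  have hsum : ∑ v ∈ τ, twoPage idx a b y v = 1 - |s| := by
    rw [← Finset.sum_coe_sort τ]
    have : ∀ v : τ, twoPage idx a b y v = 1 / n + y (idx v) - (|s| + s) / n := fun v => by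
      simp [twoPage, hs]
    rw [Finset.sum_congr rfl fun v _ => this v,
      Equiv.sum_comp idx (fun i => 1 / (n : ℝ) + y i - (|s| + s) / n), Finset.sum_sub_distrib,
      Finset.sum_add_distrib, ← hs]
    simp only [Finset.sum_const, Finset.card_univ, Fintype.card_fin, nsmul_eq_mul]
    field_simp
    ring
  have hva : twoPage idx a b y a = (|s| - s) / 2 := by simp [twoPage, ha, hs]
  have hvb : twoPage idx a b y b = (|s| + s) / 2 := by simp [twoPage, hb, hab.symm, hs]
  have hv0 : ∀ v, v ∉ τ → v ≠ a → v ≠ b → twoPage idx a b y v = 0 := fun v h1 h2 h3 => by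
    simp [twoPage, h1, h2, h3]
  refine ⟨fun v => ?_, ?_⟩
  · by_cases hv : v ∈ τ
    · simp only [twoPage, hv, dite_true]
      rw [← hs]
      have h1 := (abs_le.1 (hyi (idx ⟨v, hv⟩))).1
      have h2 : (|s| + s) / n ≤ (2 / 3) / n := by
        gcongr
        linarith [le_abs_self s]
      have h3 : (1 : ℝ) / n = 1 / (3 * n) + (2 / 3) / n := by field_simp; norm_num
      linarith
    · by_cases hva' : v = a
      · rw [hva', hva]; linarith [le_abs_self s]
      · by_cases hvb' : v = b
        · rw [hvb', hvb]; linarith [neg_abs_le s]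
        · rw [hv0 v hv hva' hvb']
  · rcases le_total s 0 with h | h
    · have hb0 : twoPage idx a b y b = 0 := by rw [hvb, abs_of_nonpos h]; ring
      refine ⟨insert a τ, haK, fun v hv => ?_, ?_⟩
      · rw [Finset.mem_insert, not_or] at hv
        by_cases hvb' : v = b
        · rw [hvb', hb0]
        · exact hv0 v hv.2 hv.1 hvb'
      · rw [Finset.sum_insert ha, hsum, hva, abs_of_nonpos h]; ring
    · have ha0 : twoPage idx a b y a = 0 := by rw [hva, abs_of_nonneg h]; ring
      refine ⟨insert b τ, hbK, fun v hv => ?_, ?_⟩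
      · rw [Finset.mem_insert, not_or] at hv
        by_cases hva' : v = a
        · rw [hva', ha0]
        · exact hv0 v hv.2 hva' hv.1
      · rw [Finset.sum_insert hb, hsum, hvb, abs_of_nonneg h]; ring

/-- By invariance of domain, a continuous injection of `ℝⁿ` into a manifold of dimension `n`,
possibly with boundary, has an image which is a neighbourhood of the image of the origin. -/
theorem range_mem_nhds_of_continuous_injective {n : ℕ} [NeZero n] {X : Type*} [TopologicalSpace X]
    (e : OpenPartialHomeomorph X (EuclideanHalfSpace n)) {φ : EuclideanSpace ℝ (Fin n) → X}
    (hφc : Continuous φ) (hφi : Function.Injective φ) (he : φ 0 ∈ e.source) :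
    range φ ∈ 𝓝 (φ 0) := by
  obtain ⟨r, hr0, hrs⟩ : ∃ r > 0, closedBall 0 r ⊆ φ ⁻¹' e.source :=
    nhds_basis_closedBall.mem_iff.1 ((e.open_source.preimage hφc).mem_nhds he)
  have hball : ∀ y ∈ closedBall (0 : EuclideanSpace ℝ (Fin n)) 1, φ (r • y) ∈ e.source := by
    intro y hy
    apply hrs
    rw [mem_closedBall_zero_iff] at hy ⊢
    rw [norm_smul, Real.norm_eq_abs, abs_of_pos hr0]
    exact mul_le_of_le_one_right hr0.le hy
  have hdom := image_closedBall_mem_nhds_of_injOn (f := fun y => (e (φ (r • y))).val)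
    (continuous_subtype_val.comp_continuousOn (e.continuousOn.comp
      (hφc.comp (continuous_const_smul r)).continuousOn hball))
    (fun y hy y' hy' h => smul_right_injective _ hr0.ne'
      (hφi (e.injOn (hball y hy) (hball y' hy') (Subtype.val_injective h))))
  rw [smul_zero] at hdom
  have hlim : Tendsto (fun x => (e x).val) (𝓝 (φ 0)) (𝓝 (e (φ 0)).val) :=
    (continuous_subtype_val.tendsto _).comp (e.continuousAt he)
  filter_upwards [hlim.eventually hdom, e.open_source.mem_nhds he] with x hx hxs
  obtain ⟨y, hy, hyx⟩ := hx
  exact ⟨r • y, e.injOn (hball y hy) hxs (Subtype.val_injective hyx)⟩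

/-- The barycentric coordinates of a point of `insert c τ`: weight `t` at `c`, the remaining weight
being distributed evenly over the `n` vertices of `τ`. -/
noncomputable def apexPoint [DecidableEq V] (n : ℕ) (τ : Finset V) (c : V) (t : ℝ) : V → ℝ :=
  fun v => if v ∈ τ then 1 / n - t / n else if v = c then t else 0

theorem apexPoint_mem_realization [DecidableEq V] {n : ℕ} (hn : 0 < n)
    {K : PreAbstractSimplicialComplex V} {τ : Finset V} (hτ : τ.card = n) {c : V} (hc : c ∉ τ)
    (hcK : insert c τ ∈ K.faces) {t : ℝ} (h0 : 0 ≤ t) (h1 : t ≤ 1) :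
    apexPoint n τ c t ∈ realization K := by
  have hn' : (0 : ℝ) < n := by exact_mod_cast hn
  refine ⟨fun v => ?_, insert c τ, hcK, fun v hv => ?_, ?_⟩
  · unfold apexPoint
    split_ifs
    · rw [← sub_div]
      exact div_nonneg (by linarith) hn'.le
    · exact h0
    · exact le_rfl
  · rw [Finset.mem_insert, not_or] at hv
    simp [apexPoint, hv.1, hv.2]
  · have h : ∀ v ∈ τ, apexPoint n τ c t v = 1 / n - t / n := fun v hv => if_pos hv
    rw [Finset.sum_insert hc, Finset.sum_congr rfl h]
    simp only [apexPoint, hc, if_false, if_true, Finset.sum_const, hτ, nsmul_eq_mul]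
    field_simp
    ring

theorem continuous_apexPoint [DecidableEq V] (n : ℕ) (τ : Finset V) (c : V) :
    Continuous (apexPoint n τ c) := by
  refine continuous_pi fun v => ?_
  unfold apexPoint
  split_ifs <;> fun_prop

/-- Three `n`-simplices cannot share a facet `τ` in an `n`-manifold complex.  By invariance of
domain, the union of the first two is a neighbourhood of the barycenter of `τ`; but that point is a
limit of interior points of the third simplex. -/
theorem not_isManifoldComplex_of_three_cofaces [DecidableEq V] {n : ℕ} [NeZero n]
    {K : PreAbstractSimplicialComplex V} {τ : Finset V} (hτ : τ.card = n) {a b c : V}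
    (ha : a ∉ τ) (hb : b ∉ τ) (hc : c ∉ τ) (hab : a ≠ b) (hac : a ≠ c) (hbc : b ≠ c)
    (haK : insert a τ ∈ K.faces) (hbK : insert b τ ∈ K.faces) (hcK : insert c τ ∈ K.faces) :
    ¬ IsManifoldComplex n K := by
  rintro ⟨-, -, hchart⟩
  have hn : 0 < n := Nat.pos_of_ne_zero (NeZero.ne n)
  have hn' : (0 : ℝ) < n := by exact_mod_cast hn
  let idx : τ ≃ Fin n := τ.equivFinOfCardEq hτ
  let U : EuclideanSpace ℝ (Fin n) → EuclideanSpace ℝ (Fin n) :=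
    OpenPartialHomeomorph.univUnitBall
  have hUc : Continuous U := by
    have := (OpenPartialHomeomorph.univUnitBall (E := EuclideanSpace ℝ (Fin n))).continuousOn
    rwa [OpenPartialHomeomorph.univUnitBall_source, continuousOn_univ] at this
  have hUi : Function.Injective U := by
    have := (OpenPartialHomeomorph.univUnitBall (E := EuclideanSpace ℝ (Fin n))).injOn
    rwa [OpenPartialHomeomorph.univUnitBall_source, injOn_univ] at this
  have hUn : ∀ y, ‖U y‖ ≤ 1 := fun y => by
    have : U y ∈ (OpenPartialHomeomorph.univUnitBall (E := EuclideanSpace ℝ (Fin n))).target :=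
      OpenPartialHomeomorph.map_source _ (by
        rw [OpenPartialHomeomorph.univUnitBall_source]; trivial)
    rw [OpenPartialHomeomorph.univUnitBall_target, mem_ball_zero_iff] at this
    exact this.le
  have hU0 : U 0 = 0 := OpenPartialHomeomorph.univUnitBall_apply_zero
  clear_value U idx
  have hr : (0 : ℝ) < 1 / (3 * n) := by positivity
  -- the first two simplices contain an injective image of the whole of `ℝⁿ`
  let ψ : EuclideanSpace ℝ (Fin n) → V → ℝ := fun y => twoPage idx a b ((1 / (3 * n) : ℝ) • U y)
  have hψK : ∀ y, ψ y ∈ realization K := fun y =>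
    twoPage_mem_realization hn idx ha hb hab haK hbK (by
      rw [norm_smul, Real.norm_eq_abs, abs_of_pos hr]
      exact mul_le_of_le_one_right hr.le (hUn y))
  have hψ0 : ψ 0 = apexPoint n τ c 0 := by
    funext v
    simp only [ψ, hU0, smul_zero]
    by_cases hv : v ∈ τ
    · simp [twoPage, apexPoint, hv]
    · simp [twoPage, apexPoint, hv]
  have hψc : Continuous ψ := (continuous_twoPage idx a b).comp (by fun_prop)
  have hψi : Function.Injective ψ := fun y z h =>
    hUi (smul_right_injective _ hr.ne' (twoPage_injective idx ha hb hab h))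
  have hψv : ∀ y, ψ y c = 0 := fun y => by simp [ψ, twoPage, hc, hac.symm, hbc.symm]
  clear_value ψ
  let φ : EuclideanSpace ℝ (Fin n) → realization K := fun y => ⟨ψ y, hψK y⟩
  obtain ⟨e, he⟩ := hchart (φ 0)
  have hrange := range_mem_nhds_of_continuous_injective e (hψc.subtype_mk hψK)
    (fun y z h => hψi (congrArg Subtype.val h)) he
  let z : ℕ → realization K := fun k => ⟨apexPoint n τ c (1 / ((k : ℝ) + 1)),
    apexPoint_mem_realization hn hτ hc hcK (by positivity) (by
      rw [div_le_one (by positivity)]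
      linarith [(Nat.cast_nonneg k : (0 : ℝ) ≤ k)])⟩
  have hz : Tendsto z atTop (𝓝 (φ 0)) := by
    rw [tendsto_subtype_rng]
    change Tendsto (fun k : ℕ => apexPoint n τ c (1 / ((k : ℝ) + 1))) atTop (𝓝 (ψ 0))
    rw [hψ0]
    exact ((continuous_apexPoint n τ c).tendsto 0).comp
      (tendsto_one_div_add_atTop_nhds_zero_nat (𝕜 := ℝ))
  obtain ⟨k, y, hy⟩ := (hz.eventually hrange).exists
  have hcoord : ψ y c = apexPoint n τ c (1 / ((k : ℝ) + 1)) c :=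
    congrFun (congrArg Subtype.val hy) c
  rw [hψv] at hcoord
  have : (0 : ℝ) < 1 / ((k : ℝ) + 1) := by positivity
  simp only [apexPoint, hc, if_false, if_true] at hcoord
  exact this.ne hcoord

/-- In an `n`-manifold complex, every `(n - 1)`-simplex lies in at most two `n`-simplices. -/
theorem card_cofaces_le_two {n : ℕ} [NeZero n] {K : PreAbstractSimplicialComplex V}
    (hK : IsManifoldComplex n K) {τ : Finset V} (hτ : τ.card = n) (S : Finset (Finset V))
    (hS : ∀ σ ∈ S, σ ∈ K.faces ∧ σ.card = n + 1 ∧ τ ⊆ σ) : S.card ≤ 2 := by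
  classical
  by_contra! h
  obtain ⟨σ₁, σ₂, σ₃, h₁, h₂, h₃, h12, h13, h23⟩ := Finset.two_lt_card_iff.1 h
  have key : ∀ σ ∈ S, ∃ a ∉ τ, insert a τ = σ := fun σ hσ =>
    Finset.exists_eq_insert_iff.2 ⟨(hS σ hσ).2.2, by rw [hτ, (hS σ hσ).2.1]⟩
  obtain ⟨a, ha, rfl⟩ := key σ₁ h₁
  obtain ⟨b, hb, rfl⟩ := key σ₂ h₂
  obtain ⟨c, hc, rfl⟩ := key σ₃ h₃
  refine not_isManifoldComplex_of_three_cofaces hτ ha hb hc ?_ ?_ ?_ (hS _ h₁).1 (hS _ h₂).1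
    (hS _ h₃).1 hK
  · rintro rfl; exact h12 rfl
  · rintro rfl; exact h13 rfl
  · rintro rfl; exact h23 rfl

end Facets

/-! ### Well-centered simplices with a common vertex -/

section WellCentered

open Set

variable {V E : Type*} [NormedAddCommGroup E] [InnerProductSpace ℝ E]

/-- The simplex spanned by the origin and the vectors `p v`, `v ∈ τ`, contains its circumcenter
`c` in its interior: `c` has positive barycentric coordinates `α v`, and `1 - ∑ α v` at the origin,
and is equidistant from the vertices, that is, `‖p v - c‖ = ‖c‖` for all `v`, which is stated in
expanded form. -/
def HasInteriorCircumcenter (p : V → E) (τ : Finset V) : Prop :=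
  ∃ (c : E) (α : V → ℝ), (∀ v ∈ τ, 0 < α v) ∧ ∑ v ∈ τ, α v < 1 ∧ c = ∑ v ∈ τ, α v • p v ∧
    ∀ v ∈ τ, ‖p v‖ ^ 2 = 2 * inner ℝ c (p v)

theorem IsWellCentered.hasInteriorCircumcenter [DecidableEq E] {n : ℕ} {S : Set (Finset E)}
    (hS : IsWellCentered n S) {f : V → E} {u : E} {τ : Finset V} (hτ : τ.card = n)
    (hf : InjOn f τ) (hu : u ∉ τ.image f) (hmem : insert u (τ.image f) ∈ S)
    (hind : AffineIndependent ℝ ((↑) : (insert u (τ.image f) : Finset E) → E)) :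
    HasInteriorCircumcenter (fun v => f v - u) τ := by
  classical
  have hcard : (insert u (τ.image f)).card = n + 1 := by
    rw [Finset.card_insert_of_notMem hu, Finset.card_image_of_injOn hf, hτ]
  let idx : Fin (n + 1) ≃ (insert u (τ.image f) : Finset E) :=
    ((insert u (τ.image f)).equivFinOfCardEq hcard).symm
  let P : Affine.Simplex ℝ E n := ⟨fun i => (idx i : E), hind.comp_embedding idx.toEmbedding⟩
  have hPr : Set.range P.points = ((insert u (τ.image f) : Finset E) : Set E) := by
    ext x
    constructor
    · rintro ⟨i, rfl⟩
      exact (idx i).2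
    · intro hx
      exact ⟨idx.symm ⟨x, hx⟩, by simp [P]⟩
  obtain ⟨w, hw1, hw, hwc⟩ := hS P ⟨_, hmem, hPr⟩
  let β : E → ℝ := fun x =>
    if h : x ∈ insert u (τ.image f) then w (idx.symm ⟨x, h⟩) else 0
  have hβ : ∀ i, β (idx i) = w i := fun i => by
    simp only [β, (idx i).2, dite_true, Subtype.coe_eta, Equiv.symm_apply_apply]
  have hβ0 : ∀ x ∈ insert u (τ.image f), 0 < β x := fun x hx => by
    simp only [β, hx, dite_true]; exact (hw _).1
  have hsumE : ∀ F : E → E, ∑ i, F (idx i) = F u + ∑ v ∈ τ, F (f v) := fun F => by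
    rw [Equiv.sum_comp idx (fun x => F x), Finset.sum_coe_sort, Finset.sum_insert hu,
      Finset.sum_image hf]
  have hsumR : ∀ F : E → ℝ, ∑ i, F (idx i) = F u + ∑ v ∈ τ, F (f v) := fun F => by
    rw [Equiv.sum_comp idx (fun x => F x), Finset.sum_coe_sort, Finset.sum_insert hu,
      Finset.sum_image hf]
  have hsum1 : β u + ∑ v ∈ τ, β (f v) = 1 := by
    rw [← hsumR, ← hw1]
    exact Finset.sum_congr rfl fun i _ => hβ i
  have hc : P.circumcenter - u = ∑ v ∈ τ, β (f v) • (f v - u) := by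
    have h1 := hsumE fun x => β x • (x - u)
    simp only [sub_self, smul_zero, zero_add] at h1
    rw [← h1, ← hwc, Finset.affineCombination_eq_linear_combination _ _ _ hw1]
    simp only [hβ, smul_sub, Finset.sum_sub_distrib, ← Finset.sum_smul, hw1, one_smul]
    rfl
  have hdist : ∀ x ∈ insert u (τ.image f), dist x P.circumcenter = P.circumradius := by
    intro x hx
    have := P.dist_circumcenter_eq_circumradius (idx.symm ⟨x, hx⟩)
    simpa [P] using this
  refine ⟨P.circumcenter - u, fun v => β (f v), fun v hv => hβ0 _ ?_, ?_, hc, fun v hv => ?_⟩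
  · exact Finset.mem_insert_of_mem (Finset.mem_image_of_mem f hv)
  · have := hβ0 u (Finset.mem_insert_self _ _)
    linarith
  · have h1 := hdist (f v) (Finset.mem_insert_of_mem (Finset.mem_image_of_mem f hv))
    rw [← hdist u (Finset.mem_insert_self _ _), dist_eq_norm, dist_eq_norm] at h1
    have h2 : f v - P.circumcenter = (f v - u) - (P.circumcenter - u) := by abel
    have h3 := norm_sub_sq_real (f v - u) (P.circumcenter - u)
    rw [← h2, h1, norm_sub_rev u, real_inner_comm] at h3
    linarith

/-- If a simplex with at least three vertices contains its circumcenter in its interior, then the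
barycentric coordinates of the circumcenter are less than `1 / 2`.  Indeed, writing `q` for the
vectors from the circumcenter to the vertices, the average of `‖q v + q k‖ ^ 2` is twice the squared
circumradius, while the term `v = k` equals four times the squared circumradius. -/
theorem circumcenter_weight_lt_half [DecidableEq V] {p : V → E} {τ : Finset V} {c : E} {α : V → ℝ}
    (hα : ∀ v ∈ τ, 0 < α v) (hα1 : ∑ v ∈ τ, α v < 1) (hc : c = ∑ v ∈ τ, α v • p v)
    (hs : ∀ v ∈ τ, ‖p v‖ ^ 2 = 2 * inner ℝ c (p v)) {k j : V} (hk : k ∈ τ) (hj : j ∈ τ)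
    (hjk : j ≠ k) (hpj : p j ≠ 0) : α k < 1 / 2 := by
  have hq : ∀ v ∈ τ, inner ℝ (p v - c) (p v - c) = inner ℝ c c := fun v hv => by
    have := hs v hv
    rw [← real_inner_self_eq_norm_sq] at this
    simp only [inner_sub_left, inner_sub_right]
    have hcomm := real_inner_comm c (p v)
    linarith
  have hterm : ∀ v ∈ τ, ‖(p v - c) + (p k - c)‖ ^ 2 =
      2 * inner ℝ c c + 2 * inner ℝ (p v - c) (p k - c) := fun v hv => by
    rw [← real_inner_self_eq_norm_sq, inner_add_left, inner_add_right, inner_add_right, hq v hv,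
      hq k hk, real_inner_comm (p v - c) (p k - c)]
    ring
  have hterm0 : ‖-c + (p k - c)‖ ^ 2 = 2 * inner ℝ c c - 2 * inner ℝ c (p k - c) := by
    rw [← real_inner_self_eq_norm_sq, inner_add_left, inner_add_right, inner_add_right, hq k hk,
      real_inner_comm (-c) (p k - c), inner_neg_left, inner_neg_left, inner_neg_right]
    ring
  have hmean : ∑ v ∈ τ, α v * inner ℝ (p v - c) (p k - c) =
      (1 - ∑ v ∈ τ, α v) * inner ℝ c (p k - c) := by
    have h1 : ∑ v ∈ τ, α v • (p v - c) = (1 - ∑ v ∈ τ, α v) • c := by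
      simp only [smul_sub, Finset.sum_sub_distrib, ← Finset.sum_smul, ← hc]
      module
    have h2 := congrArg (fun x => inner ℝ x (p k - c)) h1
    simpa only [sum_inner, real_inner_smul_left] using h2
  have htot : ∑ v ∈ τ, α v * ‖(p v - c) + (p k - c)‖ ^ 2 +
      (1 - ∑ v ∈ τ, α v) * ‖-c + (p k - c)‖ ^ 2 = 2 * inner ℝ c c := by
    have h1 : ∑ v ∈ τ, α v * ‖(p v - c) + (p k - c)‖ ^ 2 =
        (∑ v ∈ τ, α v) * (2 * inner ℝ c c) +
          2 * ∑ v ∈ τ, α v * inner ℝ (p v - c) (p k - c) := by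
      rw [Finset.sum_mul, Finset.mul_sum, ← Finset.sum_add_distrib]
      refine Finset.sum_congr rfl fun v hv => ?_
      rw [hterm v hv]; ring
    rw [h1, hterm0, hmean]
    ring
  have hkk : ‖(p k - c) + (p k - c)‖ ^ 2 = 4 * inner ℝ c c := by
    rw [hterm k hk, hq k hk]; ring
  rw [← Finset.add_sum_erase τ _ hk, hkk] at htot
  have hjmem : j ∈ τ.erase k := Finset.mem_erase.2 ⟨hjk, hj⟩
  have hge : α j * ‖(p j - c) + (p k - c)‖ ^ 2 ≤
      ∑ v ∈ τ.erase k, α v * ‖(p v - c) + (p k - c)‖ ^ 2 :=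
    Finset.single_le_sum (f := fun v => α v * ‖(p v - c) + (p k - c)‖ ^ 2)
      (fun v hv => mul_nonneg (hα v (Finset.mem_of_mem_erase hv)).le (sq_nonneg _)) hjmem
  have hαj := hα j hj
  have hα0 : 0 < 1 - ∑ v ∈ τ, α v := by linarith
  -- The terms at the origin and at `j` do not both vanish, because `p j ≠ 0`.
  have hpos : 0 < α j * ‖(p j - c) + (p k - c)‖ ^ 2 +
      (1 - ∑ v ∈ τ, α v) * ‖-c + (p k - c)‖ ^ 2 := by
    by_cases h : -c + (p k - c) = 0
    · have : (p j - c) + (p k - c) = p j := by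
        rw [show (p j - c) + (p k - c) = p j + (-c + (p k - c)) by abel, h, add_zero]
      rw [this]
      have := norm_pos_iff.2 hpj
      positivity
    · have := norm_pos_iff.2 h
      positivity
  have hcc : 0 ≤ inner ℝ c c := real_inner_self_nonneg
  nlinarith

/-- The circumcenter `c` of a simplex with an apex at the origin, projected to the span of all but
one of its further vertices, makes a positive inner product with the remaining vertex. -/
theorem inner_starProjection_circumcenter_pos [DecidableEq V] {p : V → E} {ρ : Finset V} {k : V}
    (hk : k ∉ ρ) {c : E} {α : V → ℝ} (hα : ∀ v ∈ insert k ρ, 0 < α v)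
    (hα1 : ∑ v ∈ insert k ρ, α v < 1) (hc : c = ∑ v ∈ insert k ρ, α v • p v)
    (hs : ∀ v ∈ insert k ρ, ‖p v‖ ^ 2 = 2 * inner ℝ c (p v)) (hρ : ρ.Nonempty)
    (hp : ∀ v ∈ insert k ρ, p v ≠ 0) (H : Submodule ℝ E) [H.HasOrthogonalProjection]
    (hH : ∀ v ∈ ρ, p v ∈ H) : 0 < inner ℝ (H.starProjection c) (p k) := by
  obtain ⟨j, hj⟩ := hρ
  have hkm := Finset.mem_insert_self k ρ
  have hjm := Finset.mem_insert_of_mem (b := k) hj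
  have hhalf := circumcenter_weight_lt_half hα hα1 hc hs hkm hjm (fun h => hk (h ▸ hj)) (hp j hjm)
  have hsub : c - H.starProjection c = α k • (p k - H.starProjection (p k)) := by
    have h1 : ∑ v ∈ ρ, α v • p v ∈ H := Submodule.sum_mem _ fun v hv => H.smul_mem _ (hH v hv)
    rw [hc, Finset.sum_insert hk, map_add, map_smul, Submodule.starProjection_eq_self_iff.2 h1]
    module
  have h2 : inner ℝ (H.starProjection (p k)) (p k) = ‖H.starProjection (p k)‖ ^ 2 := by
    have h := H.starProjection_inner_eq_zero (p k) _ (H.starProjection_apply_mem (p k))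
    rw [inner_sub_left, sub_eq_zero, real_inner_self_eq_norm_sq] at h
    rw [real_inner_comm, h]
  have h3 : inner ℝ (H.starProjection c) (p k) =
      inner ℝ c (p k) - α k * (‖p k‖ ^ 2 - ‖H.starProjection (p k)‖ ^ 2) := by
    have h4 := congrArg (fun x => inner ℝ x (p k)) hsub
    simp only [inner_sub_left, real_inner_smul_left, h2, real_inner_self_eq_norm_sq] at h4
    linarith
  rw [h3]
  have h5 := hs k hkm
  have h6 : 0 < ‖p k‖ := norm_pos_iff.2 (hp k hkm)
  have h7 := hα k hkm
  nlinarith [mul_pos h6 h6, mul_nonneg h7.le (sq_nonneg ‖H.starProjection (p k)‖)]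

/-- If two facets of the vertex set `σ` span, together with the origin, simplices that contain their
circumcenters in their interiors, then all the vectors `p v`, `v ∈ σ`, lie in an open half-space
bounded by a hyperplane through the origin.  The half-space is given by the circumcenter of the
common face of these two simplices, which is the projection of both circumcenters. -/
theorem exists_inner_pos_of_hasInteriorCircumcenter [DecidableEq V] {p : V → E} {σ : Finset V}
    {a b : V} (ha : a ∈ σ) (hb : b ∈ σ) (hab : a ≠ b) (hσ : 3 ≤ σ.card)
    (hp : ∀ v ∈ σ, p v ≠ 0) (h₁ : HasInteriorCircumcenter p (σ.erase a))
    (h₂ : HasInteriorCircumcenter p (σ.erase b)) : ∃ m : E, ∀ v ∈ σ, 0 < inner ℝ m (p v) := by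
  set ρ := (σ.erase a).erase b with hρ
  have hb' : b ∈ σ.erase a := Finset.mem_erase.2 ⟨hab.symm, hb⟩
  have ha' : a ∈ σ.erase b := Finset.mem_erase.2 ⟨hab, ha⟩
  have e₁ : σ.erase a = insert b ρ := (Finset.insert_erase hb').symm
  have e₂ : σ.erase b = insert a ρ := by
    rw [hρ, Finset.erase_right_comm, Finset.insert_erase ha']
  have hbρ : b ∉ ρ := Finset.notMem_erase _ _
  have haρ : a ∉ ρ := fun h => Finset.notMem_erase a σ (Finset.mem_of_mem_erase h)
  have hρne : ρ.Nonempty := by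
    rw [← Finset.card_pos, hρ, Finset.card_erase_of_mem hb', Finset.card_erase_of_mem ha]
    omega
  obtain ⟨c₁, α₁, hα₁, hα₁1, hc₁, hs₁⟩ := h₁
  obtain ⟨c₂, α₂, hα₂, hα₂1, hc₂, hs₂⟩ := h₂
  have hp₁ : ∀ v ∈ σ.erase a, p v ≠ 0 := fun v hv => hp v (Finset.mem_of_mem_erase hv)
  have hp₂ : ∀ v ∈ σ.erase b, p v ≠ 0 := fun v hv => hp v (Finset.mem_of_mem_erase hv)
  rw [e₁] at hα₁ hα₁1 hc₁ hs₁ hp₁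
  rw [e₂] at hα₂ hα₂1 hc₂ hs₂ hp₂
  let H : Submodule ℝ E := Submodule.span ℝ (p '' ρ)
  have : FiniteDimensional ℝ H := FiniteDimensional.span_of_finite ℝ (ρ.finite_toSet.image p)
  have hH : ∀ v ∈ ρ, p v ∈ H := fun v hv => Submodule.subset_span ⟨v, hv, rfl⟩
  have hproj : H.starProjection c₁ = H.starProjection c₂ := by
    -- both circumcenters have inner product `‖p v‖ ^ 2 / 2` with `p v` for `v ∈ ρ`
    have hle : H ≤ (Submodule.span ℝ {c₁ - c₂})ᗮ := by
      refine Submodule.span_le.2 ?_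
      rintro _ ⟨v, hv, rfl⟩
      have e1 := hs₁ v (Finset.mem_insert_of_mem hv)
      have e2 := hs₂ v (Finset.mem_insert_of_mem hv)
      refine Submodule.mem_orthogonal_singleton_iff_inner_right.2 ?_
      rw [inner_sub_left]
      linarith
    have hmem : c₁ - c₂ ∈ Hᗮ := fun x hx => by
      rw [real_inner_comm]
      exact Submodule.mem_orthogonal_singleton_iff_inner_right.1 (hle hx)
    rw [← sub_eq_zero, ← map_sub]
    exact (Submodule.starProjection_apply_eq_zero_iff H).2 hmem
  refine ⟨H.starProjection c₁, fun v hv => ?_⟩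
  by_cases hva : v = a
  · rw [hva, hproj]
    exact inner_starProjection_circumcenter_pos haρ hα₂ hα₂1 hc₂ hs₂ hρne hp₂ H hH
  by_cases hvb : v = b
  · rw [hvb]
    exact inner_starProjection_circumcenter_pos hbρ hα₁ hα₁1 hc₁ hs₁ hρne hp₁ H hH
  have hvρ : v ∈ ρ := by simp [hρ, hva, hvb, hv]
  have h1 := H.starProjection_inner_eq_zero c₁ _ (hH v hvρ)
  rw [inner_sub_left] at h1
  have h2 := hs₁ v (Finset.mem_insert_of_mem hvρ)
  have h3 : 0 < ‖p v‖ := norm_pos_iff.2 (hp v hv)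
  nlinarith [mul_pos h3 h3]

end WellCentered

/-! ### Parity of the facets met by a generic ray -/

section Cone

open Set

variable {V E : Type*} [NormedAddCommGroup E] [InnerProductSpace ℝ E]

/-- The vector `w` lies in the convex cone generated by the vectors `p v`, `v ∈ τ`; equivalently,
for `w ≠ 0`, the open ray in direction `w` meets the simplex spanned by these vectors. -/
def InCone (p : V → E) (τ : Finset V) (w : E) : Prop :=
  ∃ l : V → ℝ, (∀ v ∈ τ, 0 ≤ l v) ∧ ∑ v ∈ τ, l v • p v = w

theorem mem_span_image_erase [DecidableEq V] {p : V → E} {s : Finset V} {l : V → ℝ} {w : E}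
    {j : V} (hw : ∑ v ∈ s, l v • p v = w) (hj : l j = 0) :
    w ∈ Submodule.span ℝ (p '' (s.erase j)) := by
  rw [← hw, ← Finset.sum_erase s (a := j) (by rw [hj, zero_smul])]
  exact Submodule.sum_mem _ fun v hv => Submodule.smul_mem _ _ (Submodule.subset_span ⟨v, hv, rfl⟩)

/-- Let `w` be a vector in general position with respect to `n + 1` vectors of an `n`-dimensional
space which all lie in an open half-space.  Then `w` lies in an even number of the cones generated
by `n` of them.  The number is in fact `0` or `2`: the ways to write `w` as a nonnegative
combination of all the vectors form a segment, if there are any, whose endpoints correspond to those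
cones. -/
theorem even_card_filter_inCone_erase [DecidableEq V] [FiniteDimensional ℝ E] {p : V → E}
    {σ : Finset V} (hσ : σ.card = Module.finrank ℝ E + 1) {m : E}
    (hm : ∀ v ∈ σ, 0 < inner ℝ m (p v)) {w : E}
    (hgen : ∀ ρ ⊆ σ, ρ.card < Module.finrank ℝ E → w ∉ Submodule.span ℝ (p '' ρ))
    [DecidablePred fun v => InCone p (σ.erase v) w] :
    Even (σ.filter fun v => InCone p (σ.erase v) w).card := by
  rcases (σ.filter fun v => InCone p (σ.erase v) w).eq_empty_or_nonempty with h0 | ⟨v, hv⟩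
  · rw [h0]; simp
  obtain ⟨hvσ, l, hl, hlw⟩ := Finset.mem_filter.1 hv
  have hcard : ∀ x ∈ σ, (σ.erase x).card = Module.finrank ℝ E := fun x hx => by
    rw [Finset.card_erase_of_mem hx, hσ, Nat.add_sub_cancel]
  have hgen2 : ∀ x ∈ σ, ∀ y ∈ σ.erase x, w ∉ Submodule.span ℝ (p '' ((σ.erase x).erase y)) := by
    intro x hx y hy
    refine hgen _ ((Finset.erase_subset _ _).trans (Finset.erase_subset _ _)) ?_
    exact (Finset.card_erase_lt_of_mem hy).trans_eq (hcard x hx)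
  set T := σ.erase v with hT
  have hlpos : ∀ x ∈ T, 0 < l x := fun x hx => lt_of_le_of_ne (hl x hx) fun h =>
    hgen2 v hvσ x hx (mem_span_image_erase hlw h.symm)
  have hlin : LinearIndepOn ℝ p (T : Set V) := by
    rw [linearIndepOn_iff_notMem_span]
    intro x hx hmem
    apply hgen2 v hvσ x hx
    rw [← hT, Finset.coe_erase, ← hlw]
    refine Submodule.sum_mem _ fun y hy => Submodule.smul_mem _ _ ?_
    by_cases hxy : y = x
    · rw [hxy]; exact hmem
    · exact Submodule.subset_span ⟨y, ⟨hy, hxy⟩, rfl⟩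
  have huniq := linearIndepOn_finset_iff.1 hlin
  obtain ⟨μ, hμ⟩ : ∃ μ : V → ℝ, ∑ x ∈ T, μ x • p x = p v := by
    have htop : Submodule.span ℝ (Set.range fun x : (T : Set V) => p x) = ⊤ :=
      LinearIndependent.span_eq_top_of_card_eq_finrank' hlin (by simpa using hcard v hvσ)
    have hmem : p v ∈ Submodule.span ℝ (p '' (T : Set V)) := by
      rw [Set.image_eq_range]
      exact htop ▸ Submodule.mem_top
    obtain ⟨μ, hμ⟩ := (Submodule.mem_span_image_finset_iff_exists_fun ℝ).1 hmem
    refine ⟨fun x => if h : x ∈ T then μ ⟨x, h⟩ else 0, ?_⟩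
    rw [← hμ, ← Finset.sum_coe_sort]
    exact Finset.sum_congr rfl fun x _ => by simp only [x.2, dite_true, Subtype.coe_eta]
  have hJ : (T.filter fun x => 0 < μ x).Nonempty := by
    by_contra hne
    rw [Finset.not_nonempty_iff_eq_empty, Finset.filter_eq_empty_iff] at hne
    have h1 := hm v hvσ
    rw [← hμ, inner_sum] at h1
    refine absurd h1 (not_lt.2 (Finset.sum_nonpos fun x hx => ?_))
    rw [real_inner_smul_right]
    exact mul_nonpos_of_nonpos_of_nonneg (not_lt.1 (hne hx))
      (hm x (Finset.mem_of_mem_erase hx)).le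
  -- The other nonnegative solutions arise from `l` by adding `t` at `v` and subtracting `t • μ`; as
  -- `t` grows from `0`, the coordinate `k` is the first one to vanish.
  obtain ⟨k, hkJ, hkmin⟩ := Finset.exists_min_image _ (fun x => l x / μ x) hJ
  obtain ⟨hkT, hμk⟩ := Finset.mem_filter.1 hkJ
  have hkσ : k ∈ σ := Finset.mem_of_mem_erase hkT
  have hkv : k ≠ v := Finset.ne_of_mem_erase hkT
  have hset : (σ.filter fun v => InCone p (σ.erase v) w) = {v, k} := by
    ext k'
    simp only [Finset.mem_filter, Finset.mem_insert, Finset.mem_singleton]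
    constructor
    · rintro ⟨hk', ν', hν', hν'w⟩
      by_contra! hne
      obtain ⟨hk'v, hk'k⟩ := hne
      have hk'T : k' ∈ T := Finset.mem_erase.2 ⟨hk'v, hk'⟩
      let ν : V → ℝ := fun x => if x = k' then 0 else ν' x
      have hνw : ∑ x ∈ σ.erase k', ν x • p x = w := by
        rw [← hν'w]
        refine Finset.sum_congr rfl fun x hx => ?_
        simp only [ν, Finset.ne_of_mem_erase hx, if_false]
      have hν0 : ∀ x ∈ σ, 0 ≤ ν x := fun x hx => by
        by_cases h : x = k'
        · simp [ν, h]
        · simp only [ν, h, if_false]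
          exact hν' x (Finset.mem_erase.2 ⟨h, hx⟩)
      have hνk' : ν k' = 0 := by simp [ν]
      have hνσ : ν v • p v + ∑ x ∈ T, ν x • p x = w := by
        have h6 : ∑ x ∈ σ.erase k', ν x • p x = ∑ x ∈ σ, ν x • p x :=
          Finset.sum_erase σ (by rw [hνk', zero_smul])
        rw [← hνw, h6, ← Finset.add_sum_erase σ (fun x => ν x • p x) hvσ]
      have hcoef : ∀ x ∈ T, ν x + ν v * μ x - l x = 0 := by
        refine huniq (fun x => ν x + ν v * μ x - l x) ?_
        simp only [sub_smul, add_smul, Finset.sum_sub_distrib, Finset.sum_add_distrib, hlw,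
          mul_smul, ← Finset.smul_sum, hμ]
        rw [add_comm, hνσ, sub_self]
      have h1 := hcoef k' hk'T
      have h2 := hcoef k hkT
      have hνv := hν0 v hvσ
      have hμk' : 0 < μ k' := by
        by_contra! hneg
        have := hlpos k' hk'T
        nlinarith
      have h3 := hkmin k' (Finset.mem_filter.2 ⟨hk'T, hμk'⟩)
      -- the solution `ν` has `t = ν v`, so that `k` and `k'` vanish at the same time
      have h4 : l k' / μ k' = ν v := by
        rw [div_eq_iff hμk'.ne']; linarith
      rw [h4, div_le_iff₀ hμk] at h3
      have hνk : ν k = 0 := le_antisymm (by linarith) (hν0 k hkσ)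
      exact hgen2 k' hk' k (Finset.mem_erase.2 ⟨hk'k.symm, hkσ⟩) (mem_span_image_erase hνw hνk)
    · rintro (rfl | rfl)
      · exact ⟨hvσ, l, hl, hlw⟩
      · refine ⟨hkσ, fun x => if x = v then l k' / μ k' else l x - l k' / μ k' * μ x, ?_, ?_⟩
        · intro x hx
          have ht : 0 ≤ l k' / μ k' := div_nonneg (hlpos k' hkT).le hμk.le
          by_cases hxv : x = v
          · simp only [hxv, if_true]; exact ht
          · simp only [hxv, if_false]
            have hxT : x ∈ T := Finset.mem_erase.2 ⟨hxv, Finset.mem_of_mem_erase hx⟩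
            rcases le_or_gt (μ x) 0 with hμx | hμx
            · have := hl x hxT
              nlinarith
            · have h3 := hkmin x (Finset.mem_filter.2 ⟨hxT, hμx⟩)
              rw [le_div_iff₀ hμx] at h3
              linarith
        · rw [Finset.sum_erase σ (by
            simp only [hkv, if_false]; rw [div_mul_cancel₀ _ hμk.ne', sub_self, zero_smul]),
            ← Finset.add_sum_erase σ _ hvσ]
          have h5 : ∀ x ∈ T, (if x = v then l k' / μ k' else l x - l k' / μ k' * μ x) • p x =
              l x • p x - (l k' / μ k') • (μ x • p x) := fun x hx => by
            rw [if_neg (Finset.ne_of_mem_erase hx), sub_smul, mul_smul]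
          rw [Finset.sum_congr rfl h5, Finset.sum_sub_distrib, hlw, ← Finset.smul_sum, hμ]
          simp only [if_true]
          abel
  rw [hset, Finset.card_pair hkv.symm]
  exact even_two

/-- Inside the open cone generated by a basis there is a vector avoiding finitely many given
subspaces, each generated by fewer vectors than the dimension. -/
theorem exists_generic_mem_cone [FiniteDimensional ℝ E] {p : V → E} {τ : Finset V}
    (hτ : τ.card = Module.finrank ℝ E) (hlin : LinearIndepOn ℝ p (τ : Set V))
    (𝓢 : Finset (Finset V)) (h𝓢 : ∀ ρ ∈ 𝓢, ρ.card < Module.finrank ℝ E) :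
    ∃ w, InCone p τ w ∧ ∀ ρ ∈ 𝓢, w ∉ Submodule.span ℝ (p '' ρ) := by
  classical
  borelize E
  let μ : MeasureTheory.Measure E := MeasureTheory.Measure.addHaar
  have hτ' : Fintype.card (τ : Set V) = Module.finrank ℝ E := by simpa using hτ
  by_cases hne : Nonempty (τ : Set V)
  swap
  -- in dimension zero there are no subspaces to avoid
  · refine ⟨0, ⟨0, by simp, by simp⟩, fun ρ hρ => ?_⟩
    have h1 : τ.card = 0 := by
      rw [Finset.card_eq_zero, ← Finset.not_nonempty_iff_eq_empty]
      rintro ⟨x, hx⟩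
      exact hne ⟨⟨x, hx⟩⟩
    have := h𝓢 ρ hρ
    omega
  let b : Module.Basis (τ : Set V) ℝ E := basisOfLinearIndependentOfCardEqFinrank hlin hτ'
  have hb : ∀ i, b i = p i := fun i => by simp [b]
  let O : Set E := {w | ∀ i, 0 < b.coord i w}
  have hO : IsOpen O := by
    simp only [O, Set.ofPred_forall]
    exact isOpen_iInter_of_finite fun i =>
      isOpen_lt continuous_const (b.coord i).continuous_of_finiteDimensional
  have hOne : O.Nonempty := by
    refine ⟨∑ i, b i, fun i => ?_⟩
    rw [map_sum, Finset.sum_eq_single i]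
    · simp
    · intro j _ hj
      simp [hj]
    · simp
  have hnull : μ (⋃ ρ ∈ 𝓢, (Submodule.span ℝ (p '' ρ) : Set E)) = 0 := by
    refine (MeasureTheory.measure_biUnion_null_iff 𝓢.countable_toSet).2 fun ρ hρ => ?_
    apply MeasureTheory.Measure.addHaar_submodule
    intro htop
    have h1 := finrank_span_finset_le_card (R := ℝ) (ρ.image p)
    rw [Finset.coe_image, Set.finrank, htop, finrank_top] at h1
    exact absurd (h1.trans Finset.card_image_le) (not_le.2 (h𝓢 ρ hρ))
  obtain ⟨w, hwO, hw⟩ : ∃ w ∈ O, w ∉ ⋃ ρ ∈ 𝓢, (Submodule.span ℝ (p '' ρ) : Set E) := by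
    by_contra! hsub
    exact (hO.measure_pos μ hOne).ne' (MeasureTheory.measure_mono_null hsub hnull)
  refine ⟨w, ⟨fun v => if h : v ∈ (τ : Set V) then b.coord ⟨v, h⟩ w else 0, fun v hv => ?_, ?_⟩,
    fun ρ hρ h => hw (Set.mem_biUnion hρ h)⟩
  · simp only [Finset.mem_coe, hv, dite_true]
    exact (hwO _).le
  · rw [← Finset.sum_coe_sort]
    conv_rhs => rw [← b.sum_repr w]
    refine Finset.sum_congr rfl fun i _ => ?_
    rw [hb]
    simp

end Cone

/-! ### The link of a vertex and the double count -/

section Main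

open Set

variable {V : Type*}

theorem mem_vertices_of_mem {K : PreAbstractSimplicialComplex V} {s : Finset V}
    (hs : s ∈ K.faces) {v : V} (hv : v ∈ s) : v ∈ vertices K :=
  (K.isRelLowerSet_faces hs).2 (Finset.singleton_subset_iff.2 hv) (Finset.singleton_nonempty v)

/-- An isomorphism of simplicial complexes, extended arbitrarily to all points. -/
theorem IsIsomorphic.exists_map {W : Type*} [Nonempty W] [DecidableEq W]
    {K : PreAbstractSimplicialComplex V} {L : PreAbstractSimplicialComplex W}
    (h : IsIsomorphic K L) :
    ∃ f : V → W, InjOn f (vertices K) ∧ ∀ s ∈ K.faces, s.image f ∈ L.faces := by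
  classical
  obtain ⟨e, he⟩ := h
  let f : V → W := fun v => if hv : v ∈ vertices K then e ⟨v, hv⟩ else Classical.arbitrary W
  have hf : ∀ v (hv : v ∈ vertices K), f v = e ⟨v, hv⟩ := fun v hv => by
    simp only [f, hv, dite_true]
  refine ⟨f, fun v hv v' hv' hvv' => ?_, fun s hs => ?_⟩
  · rw [hf v hv, hf v' hv'] at hvv'
    exact congrArg Subtype.val (e.injective (Subtype.val_injective hvv'))
  · have h1 : (s.subtype (· ∈ vertices K)).map (Function.Embedding.subtype _) = s :=
      Finset.subtype_map_of_mem fun v hv => mem_vertices_of_mem hs hv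
    have h2 := (he (s.subtype (· ∈ vertices K))).1 (by
      have := hs
      rwa [← h1] at this)
    convert h2 using 1
    ext w
    simp only [Finset.mem_image, Finset.mem_map, Finset.mem_subtype]
    constructor
    · rintro ⟨v, hv, rfl⟩
      exact ⟨e ⟨v, mem_vertices_of_mem hs hv⟩, ⟨⟨v, mem_vertices_of_mem hs hv⟩, hv, rfl⟩,
        (hf v _).symm⟩
    · rintro ⟨_, ⟨v, hv, rfl⟩, rfl⟩
      exact ⟨v, hv, hf v v.2⟩

/-- The facets of the boundary complex are the `(n - 1)`-simplices in exactly one `n`-simplex. -/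
theorem mem_boundary_iff_of_card {n : ℕ} (hn : 0 < n) {K : PreAbstractSimplicialComplex V}
    {τ : Finset V} (hτ : τ.card = n) : τ ∈ (boundary n K).faces ↔
      τ ∈ K.faces ∧ ∃! σ : Finset V, σ ∈ K.faces ∧ σ.card = n + 1 ∧ τ ⊆ σ := by
  constructor
  · rintro ⟨-, τ', hτ', hcard, huniq, hsub⟩
    rw [Finset.eq_of_subset_of_card_le hsub (by rw [hcard, hτ])]
    exact ⟨hτ', huniq⟩
  · rintro ⟨h1, h2⟩
    exact ⟨Finset.card_pos.1 (by omega), τ, h1, hτ, h2, Subset.rfl⟩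

theorem insert_mem_of_mem_link {E : Type*} [AddCommGroup E] [Module ℝ E] [DecidableEq E]
    {M : Geometry.SimplicialComplex ℝ E} {u : E} {t : Finset E} (ht : t ∈ (link M u).faces) :
    u ∉ t ∧ insert u t ∈ M.faces := by
  obtain ⟨-, hut, s, hs, hus, hts⟩ := ht
  exact ⟨hut, M.down_closed hs (Finset.insert_subset hus hts) (Finset.insert_nonempty u t)⟩

/-- Vectors from a vertex of an affinely independent set to the other ones are linearly
independent. -/
theorem linearIndepOn_sub_of_affineIndependent {E : Type*} [AddCommGroup E] [Module ℝ E]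
    [DecidableEq E] {f : V → E} {u : E} {τ : Finset V} (hf : InjOn f τ) (hu : u ∉ τ.image f)
    (hind : AffineIndependent ℝ ((↑) : (insert u (τ.image f) : Finset E) → E)) :
    LinearIndepOn ℝ (fun v => f v - u) (τ : Set V) := by
  have hinj : InjOn (fun v => f v - u) (τ : Set V) := fun v hv v' hv' h =>
    hf hv hv' (sub_left_injective h)
  rw [linearIndepOn_iff_image hinj]
  have h1 := (affineIndependent_set_iff_linearIndependent_vsub ℝ
    (s := ((insert u (τ.image f) : Finset E) : Set E)) (p₁ := u)
    (Finset.mem_insert_self _ _)).1 hind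
  have h2 : (fun p : E => p -ᵥ u) '' (((insert u (τ.image f) : Finset E) : Set E) \ {u}) =
      (fun v => f v - u) '' (τ : Set V) := by
    rw [Finset.coe_insert, Finset.coe_image, insert_sdiff_of_mem _ (mem_singleton u),
      sdiff_singleton_eq_self (by simpa using hu), image_image]
    rfl
  rw [h2] at h1
  exact h1

section Simplex

variable {E : Type*} [NormedAddCommGroup E] [InnerProductSpace ℝ E]

theorem add_smul_mem_convexHull {f : V → E} {u : E} {τ : Finset V} {l : V → ℝ}
    (hl : ∀ v ∈ τ, 0 ≤ l v) {ε : ℝ} (hε : 0 ≤ ε) (hs : ε * ∑ v ∈ τ, l v ≤ 1) :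
    u + ε • ∑ v ∈ τ, l v • (f v - u) ∈ convexHull ℝ (insert u (f '' τ)) := by
  have hmem := (convex_convexHull ℝ (insert u (f '' (τ : Set V)))).sum_mem
    (t := Finset.insertNone τ) (w := fun o => o.elim (1 - ε * ∑ v ∈ τ, l v) fun v => ε * l v)
    (z := fun o => o.elim u f) ?_ ?_ ?_
  · rw [Finset.sum_insertNone] at hmem
    convert hmem using 1
    simp only [Option.elim_none, Option.elim_some, smul_sub, Finset.sum_sub_distrib, sub_smul,
      one_smul, mul_smul, Finset.smul_sum, ← Finset.sum_smul]
    abel_nf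
  · intro o ho
    cases o with
    | none => simpa using hs
    | some v => exact mul_nonneg hε (hl v (by simpa using ho))
  · rw [Finset.sum_insertNone]
    simp [Finset.mul_sum]
  · intro o ho
    apply subset_convexHull
    cases o with
    | none => exact Set.mem_insert _ _
    | some v => exact Set.mem_insert_of_mem _ ⟨v, by simpa using ho, rfl⟩

theorem sub_mem_span_of_mem_convexHull {f : V → E} {u x : E} {s : Set V}
    (hx : x ∈ convexHull ℝ (insert u (f '' s))) :
    x - u ∈ Submodule.span ℝ ((fun v => f v - u) '' s) := by
  let S := Submodule.span ℝ ((fun v => f v - u) '' s)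
  have hconv : Convex ℝ {x | x - u ∈ S} := by
    intro x hx y hy a b _ _ hab
    have : a • x + b • y - u = a • (x - u) + b • (y - u) := by
      rw [smul_sub, smul_sub, sub_add_sub_comm, ← add_smul, hab, one_smul]
    change a • x + b • y - u ∈ S
    rw [this]
    exact S.add_mem (S.smul_mem a hx) (S.smul_mem b hy)
  refine convexHull_min ?_ hconv hx
  rintro y (rfl | ⟨v, hv, rfl⟩)
  · simp
  · exact Submodule.subset_span ⟨v, hv, rfl⟩

/-- The cones with apex `u` over two simplices of the link of `u` meet only in the cone over the
common face. -/
theorem mem_span_inter_of_inCone [DecidableEq V] [DecidableEq E]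
    {M : Geometry.SimplicialComplex ℝ E} {u : E}
    {f : V → E} {τ₁ τ₂ : Finset V} (h₁ : insert u (τ₁.image f) ∈ M.faces)
    (h₂ : insert u (τ₂.image f) ∈ M.faces) (hf : InjOn f (τ₁ ∪ τ₂ : Finset V)) {w : E}
    (hw₁ : InCone (fun v => f v - u) τ₁ w) (hw₂ : InCone (fun v => f v - u) τ₂ w) :
    w ∈ Submodule.span ℝ ((fun v => f v - u) '' (τ₁ ∩ τ₂ : Finset V)) := by
  obtain ⟨l₁, hl₁, hlw₁⟩ := hw₁
  obtain ⟨l₂, hl₂, hlw₂⟩ := hw₂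
  have hS₁ := Finset.sum_nonneg hl₁
  have hS₂ := Finset.sum_nonneg hl₂
  set ε : ℝ := 1 / (1 + ∑ v ∈ τ₁, l₁ v + ∑ v ∈ τ₂, l₂ v) with hεdef
  have hε : 0 < ε := by positivity
  have hε₁ : ε * ∑ v ∈ τ₁, l₁ v ≤ 1 := by
    rw [hεdef, one_div_mul_eq_div, div_le_one (by positivity)]; linarith
  have hε₂ : ε * ∑ v ∈ τ₂, l₂ v ≤ 1 := by
    rw [hεdef, one_div_mul_eq_div, div_le_one (by positivity)]; linarith
  have hm₁ := add_smul_mem_convexHull (f := f) (u := u) hl₁ hε.le hε₁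
  have hm₂ := add_smul_mem_convexHull (f := f) (u := u) hl₂ hε.le hε₂
  rw [hlw₁] at hm₁
  rw [hlw₂] at hm₂
  have hinter : u + ε • w ∈ convexHull ℝ (insert u (f '' (τ₁ ∩ τ₂ : Finset V))) := by
    have h := M.inter_subset_convexHull h₁ h₂
      ⟨by simpa only [Finset.coe_insert, Finset.coe_image] using hm₁,
        by simpa only [Finset.coe_insert, Finset.coe_image] using hm₂⟩
    rw [Finset.coe_insert, Finset.coe_insert, ← insert_inter_distrib, Finset.coe_image,
      Finset.coe_image, ← hf.image_inter (by simp) (by simp), ← Finset.coe_inter] at h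
    exact h
  have h := sub_mem_span_of_mem_convexHull hinter
  rw [add_sub_cancel_left] at h
  exact (Submodule.smul_mem_iff _ hε.ne').1 h

end Simplex

/-- If every `(n - 1)`-simplex lies in at most two `n`-simplices, and every `n`-simplex has an even
number of facets with the property `P`, then the number of facets in the boundary of `K` that have
property `P` is even. -/
theorem even_card_boundary_filter {n : ℕ} (hn : 0 < n) {K : PreAbstractSimplicialComplex V}
    [DecidableEq V] (hfin : K.faces.Finite)
    (hle : ∀ τ : Finset V, τ.card = n → ∀ S : Finset (Finset V),
      (∀ σ ∈ S, σ ∈ K.faces ∧ σ.card = n + 1 ∧ τ ⊆ σ) → S.card ≤ 2)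
    (P : Finset V → Prop) [DecidablePred P]
    (heven : ∀ σ ∈ K.faces, σ.card = n + 1 → Even (σ.filter fun v => P (σ.erase v)).card) :
    Even (Set.ncard {τ | τ ∈ (boundary n K).faces ∧ τ.card = n ∧ P τ}) := by
  classical
  set F := hfin.toFinset.filter fun σ => σ.card = n + 1 with hF
  set A := hfin.toFinset.filter fun τ => τ.card = n ∧ P τ with hA
  have hFmem : ∀ σ, σ ∈ F ↔ σ ∈ K.faces ∧ σ.card = n + 1 := fun σ => by simp [hF]
  have hAmem : ∀ τ, τ ∈ A ↔ τ ∈ K.faces ∧ τ.card = n ∧ P τ := fun τ => by simp [hA]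
  have hdouble := Finset.sum_card_bipartiteAbove_eq_sum_card_bipartiteBelow
    (s := A) (t := F) (fun τ σ => τ ⊆ σ)
  have hbelow : ∀ σ ∈ F, Even (Finset.bipartiteBelow (fun τ σ => τ ⊆ σ) A σ).card := by
    intro σ hσ
    obtain ⟨hσK, hσc⟩ := (hFmem σ).1 hσ
    convert heven σ hσK hσc using 1
    symm
    refine Finset.card_bij (fun v _ => σ.erase v) (fun v hv => ?_) (fun v hv v' hv' h => ?_)
      fun τ hτ => ?_
    · obtain ⟨hvσ, hP⟩ := Finset.mem_filter.1 hv
      have hc : (σ.erase v).card = n := by rw [Finset.card_erase_of_mem hvσ, hσc]; rfl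
      refine Finset.mem_filter.2 ⟨(hAmem _).2 ⟨?_, hc, hP⟩, Finset.erase_subset _ _⟩
      exact (K.isRelLowerSet_faces hσK).2 (Finset.erase_subset _ _)
        (Finset.card_pos.1 (by omega))
    · exact Finset.erase_injOn σ (Finset.mem_filter.1 hv).1 (Finset.mem_filter.1 hv').1 h
    · obtain ⟨hτA, hτσ⟩ := Finset.mem_filter.1 hτ
      obtain ⟨-, hτc, hτP⟩ := (hAmem τ).1 hτA
      obtain ⟨v, hv, rfl⟩ := Finset.exists_eq_insert_iff.2 ⟨hτσ, by rw [hτc, hσc]⟩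
      exact ⟨v, Finset.mem_filter.2 ⟨Finset.mem_insert_self _ _, by
        rwa [Finset.erase_insert hv]⟩, Finset.erase_insert hv⟩
  have habove : ∀ τ ∈ A, ((Finset.bipartiteAbove (fun τ σ => τ ⊆ σ) F τ).card : ZMod 2) =
      if τ ∈ (boundary n K).faces then 1 else 0 := by
    intro τ hτ
    obtain ⟨hτK, hτc, -⟩ := (hAmem τ).1 hτ
    have hmem : ∀ σ, σ ∈ Finset.bipartiteAbove (fun τ σ => τ ⊆ σ) F τ ↔
        σ ∈ K.faces ∧ σ.card = n + 1 ∧ τ ⊆ σ := fun σ => by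
      rw [Finset.bipartiteAbove, Finset.mem_filter, hFmem, and_assoc]
    have h2 := hle τ hτc _ fun σ hσ => (hmem σ).1 hσ
    have hiff : τ ∈ (boundary n K).faces ↔
        (Finset.bipartiteAbove (fun τ σ => τ ⊆ σ) F τ).card = 1 := by
      rw [mem_boundary_iff_of_card hn hτc, Finset.card_eq_one, Finset.singleton_iff_unique_mem]
      simp only [hmem, hτK, true_and]
    by_cases h : τ ∈ (boundary n K).faces
    · rw [if_pos h, hiff.1 h, Nat.cast_one]
    · rw [if_neg h]
      have h1 := fun h' => h (hiff.2 h')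
      interval_cases hk : (Finset.bipartiteAbove (fun τ σ => τ ⊆ σ) F τ).card
      · rfl
      · exact absurd rfl h1
      · rfl
  have hset : {τ | τ ∈ (boundary n K).faces ∧ τ.card = n ∧ P τ} =
      ((A.filter fun τ => τ ∈ (boundary n K).faces : Finset (Finset V)) : Set (Finset V)) := by
    ext τ
    simp only [Set.mem_ofPred_eq, Finset.coe_filter, hAmem]
    constructor
    · rintro ⟨h1, h2, h3⟩
      exact ⟨⟨((mem_boundary_iff_of_card hn h2).1 h1).1, h2, h3⟩, h1⟩
    · rintro ⟨⟨-, h2, h3⟩, h1⟩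
      exact ⟨h1, h2, h3⟩
  rw [hset, Set.ncard_coe_finset, ← ZMod.natCast_eq_zero_iff_even]
  have hcast := congrArg (Nat.cast : ℕ → ZMod 2) hdouble
  rw [Nat.cast_sum, Nat.cast_sum, Finset.sum_congr rfl habove, Finset.sum_boole] at hcast
  rw [hcast]
  exact Finset.sum_eq_zero fun σ hσ => (ZMod.natCast_eq_zero_iff_even).2 (hbelow σ hσ)

end Main

end OneRing

theorem mainTheorem1 (n : ℕ) [NeZero n] (hn : 2 ≤ n)
    (M : Geometry.SimplicialComplex ℝ (EuclideanSpace ℝ (Fin n)))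
    (hM : OneRing.HasDimension n M.toPreAbstractSimplicialComplex)
    (u : EuclideanSpace ℝ (Fin n)) (hu : OneRing.IsInteriorVertex M u)
    {V : Type*} (K : PreAbstractSimplicialComplex V)
    (hKfin : K.faces.Finite) (hKdim : OneRing.HasDimension n K)
    (hKman : OneRing.IsManifoldComplex n K)
    (hKL : OneRing.IsIsomorphic (OneRing.boundary n K)
      (OneRing.link M u).toPreAbstractSimplicialComplex)
    (hK2 : ∀ σ ∈ K.faces, σ.card = n + 1 →
      ∃ τ₁ ∈ (OneRing.boundary n K).faces, ∃ τ₂ ∈ (OneRing.boundary n K).faces,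
        τ₁ ≠ τ₂ ∧ τ₁.card = n ∧ τ₂.card = n ∧ τ₁ ⊆ σ ∧ τ₂ ⊆ σ) :
    ¬ OneRing.IsWellCentered n (OneRing.cone u (OneRing.link M u).faces) := by
  classical
  intro hwc
  have hn0 : 0 < n := by omega
  have hrank : Module.finrank ℝ (EuclideanSpace ℝ (Fin n)) = n := finrank_euclideanSpace_fin
  obtain ⟨f, hfinj, hf⟩ := hKL.exists_map
  have hinj : ∀ τ ∈ (OneRing.boundary n K).faces, Set.InjOn f τ := fun τ hτ =>
    hfinj.mono fun v hv => OneRing.mem_vertices_of_mem hτ hv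
  have hlink : ∀ τ ∈ (OneRing.boundary n K).faces,
      u ∉ τ.image f ∧ insert u (τ.image f) ∈ M.faces := fun τ hτ =>
    OneRing.insert_mem_of_mem_link (hf τ hτ)
  let p : V → EuclideanSpace ℝ (Fin n) := fun v => f v - u
  have hcenter : ∀ τ ∈ (OneRing.boundary n K).faces, τ.card = n →
      OneRing.HasInteriorCircumcenter p τ := fun τ hτ hτc =>
    hwc.hasInteriorCircumcenter hτc (hinj τ hτ) (hlink τ hτ).1
      ⟨τ.image f, hf τ hτ, Finset.coe_insert _ _⟩ (M.indep (hlink τ hτ).2)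
  have hhalf : ∀ σ ∈ K.faces, σ.card = n + 1 →
      ∃ m : EuclideanSpace ℝ (Fin n), ∀ v ∈ σ, 0 < inner ℝ m (p v) := by
    intro σ hσ hσc
    obtain ⟨τ₁, hτ₁, τ₂, hτ₂, hne, hc₁, hc₂, hs₁, hs₂⟩ := hK2 σ hσ hσc
    obtain ⟨a, ha, rfl⟩ := Finset.exists_eq_insert_iff.2 ⟨hs₁, by rw [hc₁, hσc]⟩
    obtain ⟨b, hb, hbσ⟩ := Finset.exists_eq_insert_iff.2 ⟨hs₂, by rw [hc₂, hσc]⟩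
    have e₁ : (insert a τ₁).erase a = τ₁ := Finset.erase_insert ha
    have e₂ : (insert a τ₁).erase b = τ₂ := by rw [← hbσ, Finset.erase_insert hb]
    have hbmem : b ∈ insert a τ₁ := hbσ ▸ Finset.mem_insert_self b τ₂
    have hab : a ≠ b := fun h => hne (by rw [← e₁, ← e₂, h])
    refine OneRing.exists_inner_pos_of_hasInteriorCircumcenter (Finset.mem_insert_self a τ₁) hbmem
      hab (by omega) (fun v hv h0 => ?_) (by rw [e₁]; exact hcenter τ₁ hτ₁ hc₁)
      (by rw [e₂]; exact hcenter τ₂ hτ₂ hc₂)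
    have hfv : f v = u := sub_eq_zero.1 h0
    by_cases hva : v = a
    · have : v ∈ τ₂ := e₂ ▸ Finset.mem_erase.2 ⟨hva ▸ hab, hv⟩
      exact (hlink τ₂ hτ₂).1 (hfv ▸ Finset.mem_image_of_mem f this)
    · have : v ∈ τ₁ := e₁ ▸ Finset.mem_erase.2 ⟨hva, hv⟩
      exact (hlink τ₁ hτ₁).1 (hfv ▸ Finset.mem_image_of_mem f this)
  obtain ⟨σ₀, hσ₀, hσ₀c⟩ := hKdim.2
  obtain ⟨τ₀, hτ₀, -, -, -, hτ₀c, -, -, -⟩ := hK2 σ₀ hσ₀ hσ₀c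
  -- a direction in the cone over `τ₀`, in general position with respect to all simplices
  obtain ⟨w, hw₀, hw⟩ := OneRing.exists_generic_mem_cone (p := p) (hτ₀c.trans hrank.symm)
    (OneRing.linearIndepOn_sub_of_affineIndependent (hinj τ₀ hτ₀) (hlink τ₀ hτ₀).1
      (M.indep (hlink τ₀ hτ₀).2))
    ((hKfin.toFinset.biUnion Finset.powerset).filter fun ρ => ρ.card < n)
    fun ρ hρ => by rw [hrank]; exact (Finset.mem_filter.1 hρ).2
  have hgen : ∀ σ ∈ K.faces, ∀ ρ ⊆ σ, ρ.card < n → w ∉ Submodule.span ℝ (p '' ρ) :=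
    fun σ hσ ρ hρσ hρc => hw ρ (Finset.mem_filter.2
      ⟨Finset.mem_biUnion.2 ⟨σ, hKfin.mem_toFinset.2 hσ, Finset.mem_powerset.2 hρσ⟩, hρc⟩)
  have heven := OneRing.even_card_boundary_filter hn0 hKfin
    (fun τ hτ S hS => OneRing.card_cofaces_le_two hKman hτ S hS)
    (fun τ => OneRing.InCone p τ w) fun σ hσ hσc => by
      obtain ⟨m, hm⟩ := hhalf σ hσ hσc
      exact OneRing.even_card_filter_inCone_erase (by rw [hσc, hrank]) hm fun ρ hρσ hρc =>
        hgen σ hσ ρ hρσ (by rwa [hrank] at hρc)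
  have hsingle : {τ | τ ∈ (OneRing.boundary n K).faces ∧ τ.card = n ∧ OneRing.InCone p τ w} =
      {τ₀} := by
    ext τ
    simp only [Set.mem_ofPred_eq, Set.mem_singleton_iff]
    constructor
    · rintro ⟨hτ, hτc, hτw⟩
      have hspan := OneRing.mem_span_inter_of_inCone (hlink τ₀ hτ₀).2 (hlink τ hτ).2
        (hfinj.mono fun v hv => by
          rcases Finset.mem_union.1 (Finset.mem_coe.1 hv) with h | h
          · exact OneRing.mem_vertices_of_mem hτ₀ h
          · exact OneRing.mem_vertices_of_mem hτ h) hw₀ hτw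
      have hτ₀K := ((OneRing.mem_boundary_iff_of_card hn0 hτ₀c).1 hτ₀).1
      have hcard : n ≤ (τ₀ ∩ τ).card := by
        by_contra! hlt
        exact hgen τ₀ hτ₀K _ Finset.inter_subset_left hlt hspan
      have e₁ := Finset.eq_of_subset_of_card_le (Finset.inter_subset_left (s₁ := τ₀) (s₂ := τ))
        (by omega)
      have e₂ := Finset.eq_of_subset_of_card_le (Finset.inter_subset_right (s₁ := τ₀) (s₂ := τ))
        (by omega)
      exact e₂.symm.trans e₁
    · rintro rfl
      exact ⟨hτ₀, hτ₀c, hw₀⟩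
  rw [hsingle, Set.ncard_singleton] at heven
  exact Nat.not_even_one heven
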